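/- Let $\delta>0$, let $\alpha\in\mathbb{C}$ with $\mathrm{Im}(\alpha)>0$, and let $\beta\in\mathbb{C}$. Call an entire function $F$ admissible for $(\alpha,\beta,\delta)$ if its restriction to $\mathbb{R}$ is real valued, nonnegative and integrable, if $F(\alpha)=\beta$, and if the Fourier transform $\hat F(\xi)=\int_{-\infty}^{\infty}F(x)e^{-2\pi i x\xi}\,dx$ is supported in $[-\delta,\delta]$. Let \[\kappa(\alpha,\beta,\delta)=\inf\int_{-\infty}^{\infty}F(x)\,dx,\] where the infimum is over all $F$ admissible for $(\alpha,\beta,\delta)$, and let \[K(\omega,z)=\frac{\sin \pi\delta(z-\overline{\omega})}{\pi(z-\overline{\omega})}\qquad(\omega,z\in\mathbb{C}),\] with the value $\delta$ at $z=\overline{\omega}$. Then: (i) $\kappa(\alpha,\beta,\delta)=|\beta|\,\kappa(\alpha,\beta/|\beta|,\delta)$ (the right-hand side is read as $0$ if $\beta=0$); (ii) $\kappa(\alpha,\beta,\delta)=r^{-1}\kappa(r\alpha,\beta,r^{-1}\delta)$ for each $r>0$; (iii) $\kappa(\alpha,\beta,\delta)=\kappa(\alpha+t,\beta,\delta)$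 for each $t\in\mathbb{R}$; (iv) $K(\alpha,\alpha)^2\neq\delta^2$ and \[\frac{\kappa(\alpha,\beta,\delta)}{2}=\frac{|\beta|K(\alpha,\alpha)-\delta\,\mathrm{Re}(\beta)}{K(\alpha,\alpha)^{2}-\delta^{2}}.\] Moreover, the infimum is attained by exactly one admissible function, namely $F(z)=U(z)\overline{U(\overline{z})}$ with \[U(z)=\lambda_1K(\alpha,z)+\lambda_2K(\overline{\alpha},z),\] where, if $\beta\neq0$, \[\lambda_1=|\beta|^{1/2}\,\frac{(\beta/|\beta|)K(\alpha,\alpha)-\delta}{K(\alpha,\alpha)^2-\delta^2},\qquad \lambda_2=|\beta|^{1/2}\,\frac{K(\alpha,\alpha)-(\beta/|\beta|)\delta}{K(\alpha,\alpha)^2-\delta^2},\] and $\lambda_1=\lambda_2=0$ if $\beta=0$. -/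

import Mathlib

open MeasureTheory Set
open scoped FourierTransform ComplexConjugate

noncomputable section

/-- `F` is admissible for the extremal problem with data `α, β, δ`. A function on `ℝ` whose Fourier
transform has bounded support is the restriction of exactly one entire function, and `F` denotes
that entire function, so that `F α` makes sense. The Fourier transform of the restriction to `ℝ` is
`ξ ↦ ∫ x, exp (-2 π i x ξ) F x`. -/
structure IsAdmissible (α β : ℂ) (δ : ℝ) (F : ℂ → ℂ) : Prop where
  entire : Differentiable ℂ F
  real_on_real : ∀ x : ℝ, (F x).im = 0
  nonneg_on_real : ∀ x : ℝ, 0 ≤ (F x).re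
  integrable : Integrable (fun x : ℝ => F x)
  interpolates : F α = β
  fourier_support : Function.support (𝓕 (fun x : ℝ => F x)) ⊆ Icc (-δ) δ

/-- The integral over the real line of a function that is real valued there. -/
def lineIntegral (F : ℂ → ℂ) : ℝ := ∫ x : ℝ, (F x).re

/-- The infimum of `∫ F` over the admissible functions. -/
def kappa (α β : ℂ) (δ : ℝ) : ℝ :=
  sInf {s : ℝ | ∃ F : ℂ → ℂ, IsAdmissible α β δ F ∧ s = lineIntegral F}

/-- The kernel `sin (π δ (z - conj ω)) / (π (z - conj ω))`, with its removable singularity at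
`z = conj ω` filled in. -/
def sincKernel (δ : ℝ) (ω z : ℂ) : ℂ :=
  if z = conj ω then (δ : ℂ)
  else Complex.sin (Real.pi * δ * (z - conj ω)) / (Real.pi * (z - conj ω))

/-- The coefficient `λ₁`; for `‖β‖ = 1` it is `(β K(α,α) - δ) / (K(α,α)² - δ²)`, and it is `0` for
`β = 0`. -/
def lambda₁ (α β : ℂ) (δ : ℝ) : ℂ :=
  (Real.sqrt ‖β‖ : ℂ) *
    (((β / (‖β‖ : ℂ)) * sincKernel δ α α - δ) / (sincKernel δ α α ^ 2 - (δ : ℂ) ^ 2))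

/-- The coefficient `λ₂`; for `‖β‖ = 1` it is `(K(α,α) - β δ) / (K(α,α)² - δ²)`, and it is `0` for
`β = 0`. -/
def lambda₂ (α β : ℂ) (δ : ℝ) : ℂ :=
  (Real.sqrt ‖β‖ : ℂ) *
    ((sincKernel δ α α - (β / (‖β‖ : ℂ)) * δ) / (sincKernel δ α α ^ 2 - (δ : ℂ) ^ 2))

/-- `U = λ₁ K(α, ·) + λ₂ K(conj α, ·)`. -/
def extremalU (α β : ℂ) (δ : ℝ) (z : ℂ) : ℂ :=
  lambda₁ α β δ * sincKernel δ α z + lambda₂ α β δ * sincKernel δ (conj α) z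

/-- `F = U U*`, where `U*` is `z ↦ conj (U (conj z))`. -/
def extremalF (α β : ℂ) (δ : ℝ) (z : ℂ) : ℂ :=
  extremalU α β δ z * conj (extremalU α β δ (conj z))

end

/-! If `F = U U*` with `U` in the Paley–Wiener space of spectrum `[-δ/2, δ/2]`, then `∫ F = ‖U‖²`,
and `F α = a * conj b` where `a`, `b` are the values of `U` at `α`, `conj α`. These values are inner
products of `U` with two kernels whose Gram matrix is `G = [[K, δ], [δ, K]]`, `K = K(α, α)`.
Projecting `U` on their span gives `‖U‖² ≥ v* G⁻¹ v` for `v = (a, b)`. Since `‖a‖² + ‖b‖² = 2 ‖β‖ +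
(‖a‖ - ‖b‖)²`, this bound is the claimed value plus the defect `K (‖a‖ - ‖b‖)² / (K² - δ²)`.
Equality forces `‖a‖ = ‖b‖` and `U` in the span, so `U` is fixed up to a phase that cancels in `U
U*`.

The factorisation of an admissible `F` is never produced in the limit; it is replaced by finite
ones. Sampling the Fourier transform of `F` at the multiples of `δ/n` gives a nonnegative
trigonometric polynomial. After adding a small constant, `fejer_riesz` factors it, and the
coefficients of the factor form a vector `d` in `ℂ^(n+1)` with `‖d‖²` close to `∫ F`. Sampled
kernels evaluate `d`, and their Gram matrices tend to `G` as Riemann sums. Along a subsequence the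
evaluations at `α` and `conj α` converge, so the projection inequality passes to the limit
(`IsAdmissible.exists_values`). If the residual tends to zero, the evaluations converge everywhere,
which identifies `F`.

Conversely every `U U*` with `U` in the span is admissible: its Fourier transform is the
autocorrelation of the spectrum of `U` (`fourier_kernelSquare`). The scaling laws are read off the
closed formula. -/

namespace Polynomial

/-! ### Conjugate-reciprocal polynomials and the Fejér–Riesz factorisation. -/

theorem eval_reflect_map_conj {N : ℕ} {p : ℂ[X]} (hp : p.natDegree ≤ N) {z : ℂ} (hz0 : z ≠ 0) :
    (reflect N (p.map (starRingEnd ℂ))).eval z = z ^ N * conj (p.eval (conj z⁻¹)) := by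
  let _ : Invertible (z⁻¹) := invertibleOfNonzero (inv_ne_zero hz0)
  have h := eval₂_reflect_mul_pow (RingHom.id ℂ) (z⁻¹) N (p.map (starRingEnd ℂ))
    (natDegree_map_le.trans hp)
  have h1 : (⅟(z⁻¹) : ℂ) = z := by rw [invOf_eq_inv, inv_inv]
  have h2 : (p.map (starRingEnd ℂ)).eval z⁻¹ = conj (p.eval (conj z⁻¹)) := by
    conv_lhs => rw [← Complex.conj_conj (z⁻¹), eval_map, eval₂_hom]
  rw [h1, eval₂_id, eval₂_id, h2, inv_pow] at h
  rw [← h]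
  field_simp

theorem eval_reflect_map_conj_of_norm_eq_one {N : ℕ} {p : ℂ[X]} (hp : p.natDegree ≤ N) {z : ℂ}
    (hz : ‖z‖ = 1) :
    (reflect N (p.map (starRingEnd ℂ))).eval z = z ^ N * conj (p.eval z) := by
  have hz0 : z ≠ 0 := by rintro rfl; simp at hz
  rw [eval_reflect_map_conj hp hz0, Complex.inv_eq_conj hz, Complex.conj_conj]

/-- The points `exp (n i)` are distinct because `π` is irrational. Infinitude lets identities on the
circle become polynomial identities. -/
theorem infinite_norm_eq_one : {z : ℂ | ‖z‖ = 1}.Infinite := by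
  have h : Function.Injective fun n : ℕ => Complex.exp (n * Complex.I) := by
    intro m n hmn
    obtain ⟨k, hk⟩ := Complex.exp_eq_exp_iff_exists_int.1 hmn
    have h1 : (m : ℂ) = n + k * (2 * Real.pi) := by
      have := congrArg (fun w => w * (-Complex.I)) hk
      ring_nf at this
      simp only [Complex.I_sq] at this
      linear_combination this
    have h2 : (m : ℝ) = n + k * (2 * Real.pi) := by exact_mod_cast h1
    have hk0 : k = 0 := by
      by_contra hk0
      refine irrational_pi.ne_rat (((m : ℚ) - n) / (2 * k)) ?_
      have : (k : ℝ) ≠ 0 := by exact_mod_cast hk0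
      push_cast
      field_simp
      linarith
    subst hk0
    simpa using h2
  refine (Set.infinite_range_of_injective h).mono ?_
  rintro _ ⟨n, rfl⟩
  simpa using Complex.norm_exp_ofReal_mul_I n

/-- The **Fejér–Riesz theorem** for strictly positive trigonometric polynomials. -/
theorem fejer_riesz (n : ℕ) (p : ℂ[X]) (hdeg : p.natDegree ≤ 2 * n)
    (hpos : ∀ z : ℂ, ‖z‖ = 1 → ∃ r : ℝ, 0 < r ∧ p.eval z = r * z ^ n) :
    ∃ q : ℂ[X], q.natDegree ≤ n ∧ p = q * reflect n (q.map (starRingEnd ℂ)) := by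
  induction n generalizing p with
  | zero =>
    obtain ⟨c, rfl⟩ := natDegree_eq_zero.1 (Nat.le_zero.1 hdeg)
    obtain ⟨r, hr, h⟩ := hpos 1 (by simp)
    simp only [eval_C, one_pow, mul_one] at h
    refine ⟨C ((Real.sqrt r : ℝ) : ℂ), by simp, ?_⟩
    rw [map_C, reflect_C, Complex.conj_ofReal, pow_zero, mul_one, ← C_mul, ← Complex.ofReal_mul,
      Real.mul_self_sqrt hr.le, h]
  | succ n ih =>
    -- `p z / z ^ (n + 1)` is real on the circle, so `p` is its own conjugate reciprocal and its
    -- nonzero roots come in pairs `a`, `1 / conj a`.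
    have hself : p = reflect (2 * (n + 1)) (p.map (starRingEnd ℂ)) := by
      refine eq_of_infinite_eval_eq _ _ (infinite_norm_eq_one.mono fun z hz => ?_)
      obtain ⟨r, -, h⟩ := hpos z hz
      have hz0 : z ≠ 0 := by rintro rfl; simp at hz
      change p.eval z = _
      rw [eval_reflect_map_conj_of_norm_eq_one hdeg hz, h, map_mul, map_pow, Complex.conj_ofReal,
        ← Complex.inv_eq_conj hz, two_mul, pow_add, inv_pow]
      field_simp
      ring
    have hp0 : p ≠ 0 := by
      rintro rfl
      obtain ⟨r, hr, h⟩ := hpos 1 (by simp)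
      rw [eval_zero, one_pow, mul_one] at h
      exact hr.ne (by exact_mod_cast h)
    -- Strict positivity excludes roots on the circle, where the two members of a pair would
    -- coincide.
    have hne : ∀ z : ℂ, ‖z‖ = 1 → p.eval z ≠ 0 := by
      intro z hz h0
      obtain ⟨r, hr, h⟩ := hpos z hz
      rw [h0] at h
      have hz0 : z ≠ 0 := by rintro rfl; simp at hz
      exact mul_ne_zero (Complex.ofReal_ne_zero.2 hr.ne') (pow_ne_zero _ hz0) h.symm
    have hroot : ∃ a, p.eval a = 0 := by
      by_contra! hno
      have hd : p.degree = 0 := by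
        by_contra hd
        obtain ⟨a, ha⟩ := Complex.exists_root (natDegree_pos_iff_degree_pos.1 <|
          Nat.pos_of_ne_zero fun h => hd (by rw [degree_eq_natDegree hp0, h]; rfl))
        exact hno a ha
      have hc := eq_C_of_degree_eq_zero hd
      have h0 : p.coeff 0 = 0 := by
        rw [hself, coeff_reflect, revAt_le (Nat.zero_le _), coeff_map, hc, Nat.sub_zero,
          coeff_C_of_ne_zero (by omega), map_zero]
      exact hp0 (by rw [hc, h0, C_0])
    obtain ⟨a, ha⟩ := hroot
    -- The root `0` is paired with infinity: the top coefficient vanishes too, so dividing by `X`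
    -- lowers the degree bound by two.
    by_cases ha0 : a = 0
    · subst ha0
      have hc0 : p.coeff 0 = 0 := by rwa [coeff_zero_eq_eval_zero]
      have htop : p.coeff (2 * (n + 1)) = 0 := by
        rw [hself, coeff_reflect, revAt_le le_rfl, coeff_map, Nat.sub_self, hc0, map_zero]
      obtain ⟨p₁, rfl⟩ := X_dvd_iff.2 hc0
      have hp1 : p₁ ≠ 0 := right_ne_zero_of_mul hp0
      have hd1 : p₁.natDegree ≤ 2 * n := by
        rw [natDegree_X_mul hp1] at hdeg
        by_contra hlt
        have : p₁.natDegree = 2 * n + 1 := by omega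
        rw [show 2 * (n + 1) = p₁.natDegree + 1 by omega, coeff_X_mul] at htop
        exact hp1 (leadingCoeff_eq_zero.1 htop)
      obtain ⟨q, hq, hpq⟩ := ih p₁ hd1 fun z hz => by
        obtain ⟨r, hr, h⟩ := hpos z hz
        have hz0 : z ≠ 0 := by rintro rfl; simp at hz
        refine ⟨r, hr, mul_left_cancel₀ hz0 ?_⟩
        rw [eval_mul, eval_X] at h
        rw [h]; ring
      refine ⟨q, by omega, ?_⟩
      have := reflect_mul (1 : ℂ[X]) (q.map (starRingEnd ℂ)) (F := 1) (G := n) (by simp)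
        (natDegree_map_le.trans hq)
      rw [one_mul, reflect_one, pow_one, add_comm] at this
      rw [this, hpq]
      ring
    · have ha1 : ‖a‖ ≠ 1 := fun h => hne a h ha
      set b : ℂ := conj a⁻¹ with hb
      have hb0 : b ≠ 0 := by simpa [hb] using ha0
      have hab : conj a * b = 1 := by
        rw [hb, ← map_mul, mul_inv_cancel₀ ha0, map_one]
      have hbroot : p.eval b = 0 := by
        rw [hself, eval_reflect_map_conj hdeg hb0, hb, ← map_inv₀, inv_inv,
          Complex.conj_conj, ha, map_zero, mul_zero]
      have hne' : b ≠ a := by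
        intro h
        rw [h] at hab
        rw [mul_comm, Complex.mul_conj, Complex.normSq_eq_norm_sq] at hab
        have : ‖a‖ ^ 2 = 1 := by exact_mod_cast hab
        exact ha1 ((pow_eq_one_iff_of_nonneg (norm_nonneg a) two_ne_zero).1 this)
      obtain ⟨p₂, rfl⟩ := dvd_iff_isRoot.2 ha
      have hb2 : p₂.eval b = 0 := by
        rw [eval_mul] at hbroot
        refine (mul_eq_zero.1 hbroot).resolve_left ?_
        simpa [sub_eq_zero] using hne'
      obtain ⟨p₃, rfl⟩ := dvd_iff_isRoot.2 hb2
      -- Up to the constant `-b`, the factor for the mirror root is the reflection of `X - a`.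
      have hfac : (X - C b) * p₃ = (1 - C (conj a) * X) * (C (-b) * p₃) := by
        have : C (conj a) * C b = (1 : ℂ[X]) := by rw [← C_mul, hab, C_1]
        rw [C_neg]
        linear_combination (-X * p₃) * this
      have hp3 : p₃ ≠ 0 := right_ne_zero_of_mul (right_ne_zero_of_mul hp0)
      have hd3 : (C (-b) * p₃).natDegree ≤ 2 * n := by
        rw [natDegree_mul (X_sub_C_ne_zero a) (mul_ne_zero (X_sub_C_ne_zero b) hp3),
          natDegree_mul (X_sub_C_ne_zero b) hp3, natDegree_X_sub_C, natDegree_X_sub_C] at hdeg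
        rw [natDegree_C_mul (neg_ne_zero.2 hb0)]
        omega
      rw [hfac] at hpos ⊢
      obtain ⟨q, hq, hpq⟩ := ih (C (-b) * p₃) hd3 fun z hz => by
        obtain ⟨r, hr, h⟩ := hpos z hz
        have hz0 : z ≠ 0 := by rintro rfl; simp at hz
        have hza : z - a ≠ 0 := fun h' => ha1 (by rw [← sub_eq_zero.1 h', hz])
        -- On the circle the removed pair is a positive multiple of `z`, so the quotient satisfies
        -- the induction hypothesis.
        have hsq : (z - a) * (1 - conj a * z) = ((‖z - a‖ ^ 2 : ℝ) : ℂ) * z := by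
          rw [← Complex.normSq_eq_norm_sq, ← Complex.mul_conj, map_sub,
            ← Complex.inv_eq_conj hz]
          field_simp
        have hn : (0 : ℝ) < ‖z - a‖ ^ 2 := by positivity
        refine ⟨r / ‖z - a‖ ^ 2, div_pos hr hn, ?_⟩
        have hn' : ((‖z - a‖ ^ 2 : ℝ) : ℂ) ≠ 0 := Complex.ofReal_ne_zero.2 hn.ne'
        rw [eval_mul, eval_mul, ← mul_assoc] at h
        simp only [eval_sub, eval_X, eval_C, eval_one, eval_mul] at h ⊢
        rw [hsq] at h
        rw [Complex.ofReal_div]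
        field_simp at h ⊢
        apply mul_left_cancel₀ hz0
        linear_combination h
      refine ⟨(X - C a) * q, ?_, ?_⟩
      · refine natDegree_mul_le.trans ?_
        rw [natDegree_X_sub_C]; omega
      · have := reflect_mul (X - C (conj a)) (q.map (starRingEnd ℂ)) (F := 1) (G := n) (by simp)
          (natDegree_map_le.trans hq)
        rw [reflect_sub, reflect_one_X, reflect_C, pow_one, add_comm] at this
        rw [Polynomial.map_mul, Polynomial.map_sub, map_X, map_C, this, hpq]
        ring

theorem coeff_mul_reflect_map_conj (n : ℕ) (q : ℂ[X]) :
    (q * reflect n (q.map (starRingEnd ℂ))).coeff n =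
      ((∑ j ∈ Finset.range (n + 1), ‖q.coeff j‖ ^ 2 : ℝ) : ℂ) := by
  rw [coeff_mul, Finset.Nat.sum_antidiagonal_eq_sum_range_succ_mk, Complex.ofReal_sum]
  refine Finset.sum_congr rfl fun j hj => ?_
  have hj' : j ≤ n := Nat.lt_succ_iff.1 (Finset.mem_range.1 hj)
  rw [coeff_reflect, revAt_le (Nat.sub_le _ _), Nat.sub_sub_self hj', coeff_map,
    Complex.mul_conj, Complex.normSq_eq_norm_sq]

end Polynomial

/-! ### Sums of finitely supported positive definite sequences. -/

theorem sum_range_shift (φ : ℤ → ℂ) (n : ℕ) :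
    ∑ k ∈ Finset.range (2 * n + 1), φ ((k : ℤ) - n) =
      φ 0 + ∑ k ∈ Finset.range n, (φ ((k : ℤ) + 1) + φ (-((k : ℤ) + 1))) := by
  induction n with
  | zero => simp
  | succ n ih =>
    rw [show 2 * (n + 1) + 1 = (2 * n + 1) + 1 + 1 by ring, Finset.sum_range_succ,
      Finset.sum_range_succ', Finset.sum_range_succ _ n, ← add_assoc, ← ih]
    have h : ∀ k : ℕ, ((k + 1 : ℕ) : ℤ) - ((n + 1 : ℕ) : ℤ) = (k : ℤ) - n := by
      intro k; push_cast; ring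
    simp only [h]
    have h1 : ((2 * n + 1 : ℕ) : ℤ) - n = n + 1 := by push_cast; ring
    have h2 : ((0 : ℕ) : ℤ) - ((n + 1 : ℕ) : ℤ) = -((n : ℤ) + 1) := by push_cast; ring
    rw [h1, h2]
    ring

/-- A finitely supported positive definite sequence has nonnegative sum. -/
theorem sum_nonneg_of_toeplitz_sum_nonneg (φ : ℤ → ℂ) (n : ℕ)
    (hφ : ∀ l : ℤ, n < |l| → φ l = 0)
    (hpos : ∀ M : ℕ, ∃ r : ℝ, 0 ≤ r ∧
      ∑ j ∈ Finset.range M, ∑ k ∈ Finset.range M, φ ((j : ℤ) - k) = r) :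
    ∃ r : ℝ, 0 ≤ r ∧ ∑ k ∈ Finset.range (2 * n + 1), φ ((k : ℤ) - n) = r := by
  set T : ℕ → ℂ := fun M => ∑ j ∈ Finset.range M, ∑ k ∈ Finset.range M, φ ((j : ℤ) - k) with hT
  set S : ℂ := ∑ k ∈ Finset.range (2 * n + 1), φ ((k : ℤ) - n) with hS
  have hrefl : ∀ (g : ℤ → ℂ) (M : ℕ),
      ∑ k ∈ Finset.range M, g ((M : ℤ) - k) = ∑ k ∈ Finset.range M, g ((k : ℤ) + 1) := by
    intro g M
    rw [← Finset.sum_range_reflect]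
    refine Finset.sum_congr rfl fun k hk => ?_
    have hk' : k < M := Finset.mem_range.1 hk
    congr 1
    omega
  -- Enlarging a Toeplitz square adds one row and one column, which meet each difference once.
  -- Beyond size `n` this border contains the whole support and sums to `S`. Hence `T` grows
  -- linearly with slope `S`, and nonnegativity of `T` forces that of `S`.
  have hstep : ∀ m : ℕ, T (n + m + 1) = T (n + m) + S := by
    intro m
    have h1 : T (n + m + 1) = T (n + m) + (φ 0 + ∑ k ∈ Finset.range (n + m),
        (φ ((k : ℤ) + 1) + φ (-((k : ℤ) + 1)))) := by
      have e1 := hrefl φ (n + m)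
      have e2 := hrefl (fun l => φ (-l)) (n + m)
      simp only [neg_sub] at e2
      simp only [hT, Finset.sum_range_succ, Finset.sum_add_distrib, ← e1, ← e2, sub_self]
      ring
    rw [h1, Finset.sum_range_add, hS, sum_range_shift, Finset.sum_eq_zero (s := Finset.range m),
      add_zero]
    intro k _
    rw [hφ, hφ, add_zero]
    · rw [abs_neg, abs_of_nonneg (by positivity)]; push_cast; omega
    · rw [abs_of_nonneg (by positivity)]; push_cast; omega
  have hlin : ∀ m : ℕ, T (n + m) = T n + m * S := by
    intro m
    induction m with
    | zero => simp
    | succ m ih => rw [← add_assoc, hstep, ih]; push_cast; ring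
  have him : S.im = 0 := by
    obtain ⟨r, -, hr⟩ := hpos (n + 1)
    obtain ⟨s, -, hs⟩ := hpos n
    have := hlin 1
    simp only [hT, hr, hs] at this
    have := congrArg Complex.im this
    simpa using this.symm
  have hre : 0 ≤ S.re := by
    by_contra! hneg
    obtain ⟨m, hm⟩ := exists_nat_gt ((T n).re / (-S.re))
    obtain ⟨r, hr0, hr⟩ := hpos (n + m)
    have h := congrArg Complex.re (hlin m)
    simp only [hT] at h hm
    rw [hr] at h
    rw [div_lt_iff₀ (by linarith)] at hm
    simp only [Complex.add_re, Complex.mul_re, Complex.natCast_re, Complex.natCast_im, zero_mul,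
      sub_zero, Complex.ofReal_re] at h
    linarith
  exact ⟨S.re, hre, Complex.ext rfl (by simp [him])⟩

/-! ### Exponentials and positivity of sampled Fourier transforms. -/

/-- The exponential `z ↦ exp (2 π i ξ z)`. -/
noncomputable def expWave (ξ : ℝ) (z : ℂ) : ℂ := Complex.exp (2 * Real.pi * Complex.I * ξ * z)

theorem expWave_add (ξ η : ℝ) (z : ℂ) : expWave (ξ + η) z = expWave ξ z * expWave η z := by
  simp only [expWave, ← Complex.exp_add]; congr 1; push_cast; ring

theorem expWave_add_right (ξ : ℝ) (z w : ℂ) :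
    expWave ξ (z + w) = expWave ξ z * expWave ξ w := by
  simp only [expWave, ← Complex.exp_add]; congr 1; ring

theorem expWave_ne_zero (ξ : ℝ) (z : ℂ) : expWave ξ z ≠ 0 := Complex.exp_ne_zero _

theorem expWave_zero (z : ℂ) : expWave 0 z = 1 := by simp [expWave]

theorem conj_expWave (ξ : ℝ) (z : ℂ) : conj (expWave ξ z) = expWave ξ (-conj z) := by
  rw [expWave, ← Complex.exp_conj, expWave]; congr 1
  simp [Complex.conj_ofNat]

theorem expWave_neg (ξ : ℝ) (z : ℂ) : expWave (-ξ) z = expWave ξ (-z) := by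
  simp [expWave]

theorem expWave_neg_right (ξ : ℝ) (z : ℂ) : expWave ξ (-z) = (expWave ξ z)⁻¹ := by
  simp [expWave, Complex.exp_neg]

theorem expWave_nat_mul (n : ℕ) (ξ : ℝ) (z : ℂ) : expWave (n * ξ) z = expWave ξ z ^ n := by
  rw [expWave, expWave, ← Complex.exp_nat_mul]; congr 1; push_cast; ring

theorem norm_expWave_ofReal (ξ x : ℝ) : ‖expWave ξ x‖ = 1 := by
  rw [expWave, show 2 * (Real.pi : ℂ) * Complex.I * ξ * x = ((2 * Real.pi * ξ * x : ℝ) : ℂ) *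
    Complex.I by push_cast; ring]
  exact Complex.norm_exp_ofReal_mul_I _

theorem continuous_expWave : Continuous fun p : ℝ × ℂ => expWave p.1 p.2 := by
  unfold expWave; fun_prop

theorem fourier_eq_integral_expWave (f : ℝ → ℂ) (ξ : ℝ) :
    𝓕 f ξ = ∫ t : ℝ, expWave (-ξ) t * f t := by
  rw [Real.fourier_real_eq_integral_exp_smul]
  refine integral_congr_ae (.of_forall fun t => ?_)
  simp only [smul_eq_mul, expWave]
  congr 2; push_cast; ring

theorem fourierInv_eq_integral_expWave (f : ℝ → ℂ) (x : ℝ) :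
    𝓕⁻ f x = ∫ t : ℝ, expWave t x * f t := by
  rw [Real.fourierInv_eq']
  refine integral_congr_ae (.of_forall fun t => ?_)
  simp only [smul_eq_mul, expWave]
  congr 2
  simp
  ring

/-- The easy half of Bochner's theorem: the double sum is the integral of `f` against the squared
modulus of an exponential sum. -/
theorem toeplitz_sum_fourier_nonneg {f : ℝ → ℂ} (hf : Integrable f) (him : ∀ t, (f t).im = 0)
    (hre : ∀ t, 0 ≤ (f t).re) (h x : ℝ) (M : ℕ) :
    ∃ r : ℝ, 0 ≤ r ∧ ∑ j ∈ Finset.range M, ∑ k ∈ Finset.range M,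
      𝓕 f (((j : ℤ) - (k : ℤ) : ℤ) * h) * expWave (((j : ℤ) - (k : ℤ) : ℤ) * h) x = r := by
  set g : ℝ → ℂ := fun t => ∑ j ∈ Finset.range M, expWave (j * h) (x - t : ℝ) with hg
  refine ⟨∫ t, ‖g t‖ ^ 2 * (f t).re, integral_nonneg fun t => mul_nonneg (by positivity) (hre t),
    ?_⟩
  rw [← integral_complex_ofReal]
  have hterm : ∀ j k : ℕ,
      𝓕 f (((j : ℤ) - (k : ℤ) : ℤ) * h) * expWave (((j : ℤ) - (k : ℤ) : ℤ) * h) x =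
      ∫ t : ℝ, expWave (j * h) (x - t : ℝ) * conj (expWave (k * h) (x - t : ℝ)) * f t := by
    intro j k
    rw [fourier_eq_integral_expWave, mul_comm, ← integral_const_mul]
    refine integral_congr_ae (.of_forall fun t => ?_)
    simp only [expWave, ← Complex.exp_conj, ← Complex.exp_add, ← mul_assoc]
    congr 2
    simp [Complex.conj_ofNat]
    ring
  have hint : ∀ j k : ℕ, Integrable fun t : ℝ =>
      expWave (j * h) (x - t : ℝ) * conj (expWave (k * h) (x - t : ℝ)) * f t := by
    intro j k
    refine hf.bdd_mul (c := 1) ?_ (.of_forall fun t => ?_)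
    · refine Continuous.aestronglyMeasurable ?_
      unfold expWave; fun_prop
    · rw [norm_mul, RCLike.norm_conj, norm_expWave_ofReal, norm_expWave_ofReal, one_mul]
  simp only [hterm]
  rw [Finset.sum_congr rfl fun j _ => (integral_finsetSum _ fun k _ => hint j k).symm,
    ← integral_finsetSum _ fun j _ => integrable_finsetSum _ fun k _ => hint j k]
  refine integral_congr_ae (.of_forall fun t => ?_)
  have hft : f t = ((f t).re : ℂ) := Complex.ext rfl (by simp [him])
  simp only [Complex.ofReal_mul]
  rw [← Complex.normSq_eq_norm_sq, ← Complex.mul_conj, ← hft, hg]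
  simp only [map_sum, Finset.mul_sum, Finset.sum_mul]
  exact Finset.sum_comm

/-- By Poisson summation the sum is, up to a positive factor, a periodisation of `f`. Positive
definiteness yields the sign directly; spacing `δ / n` confines the nonzero samples to indices of
modulus at most `n`. -/
theorem sum_fourier_expWave_nonneg {f : ℝ → ℂ} (hf : Integrable f) (him : ∀ t, (f t).im = 0)
    (hre : ∀ t, 0 ≤ (f t).re) {δ : ℝ} (hδ : 0 < δ) (hsupp : Function.support (𝓕 f) ⊆ Icc (-δ) δ)
    {n : ℕ} (hn : 0 < n) (x : ℝ) :
    ∃ r : ℝ, 0 ≤ r ∧ ∑ k ∈ Finset.range (2 * n + 1),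
      𝓕 f (((k : ℤ) - (n : ℤ) : ℤ) * (δ / n)) * expWave (((k : ℤ) - (n : ℤ) : ℤ) * (δ / n)) x
        = r := by
  refine sum_nonneg_of_toeplitz_sum_nonneg
    (fun l : ℤ => 𝓕 f (l * (δ / n)) * expWave (l * (δ / n)) x) n (fun l hl => ?_)
    fun M => toeplitz_sum_fourier_nonneg hf him hre (δ / n) x M
  have h0 : 𝓕 f (l * (δ / n)) = 0 := by
    by_contra hne
    have hmem := hsupp (Function.mem_support.2 hne)
    rw [Set.mem_Icc, ← abs_le, abs_mul, abs_of_pos (by positivity : 0 < δ / n)] at hmem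
    have hl' : (n : ℝ) < |(l : ℝ)| := by exact_mod_cast hl
    have hn' : (0 : ℝ) < n := by exact_mod_cast hn
    rw [← mul_div_assoc, div_le_iff₀ hn', mul_comm] at hmem
    nlinarith
  simp only [h0, zero_mul]

open Filter Topology

/-! ### Riemann sums and integral representations. -/

theorem tendsto_riemann_sum {f : ℝ → ℂ} (hf : Continuous f) {a b : ℝ} (hab : a ≤ b) :
    Tendsto (fun m : ℕ => (((b - a) / m : ℝ) : ℂ) *
      ∑ k ∈ Finset.range (m + 1), f (a + k * ((b - a) / m))) atTop (𝓝 (∫ t in a..b, f t)) := by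
  -- Both endpoints are nodes, to match the `n + 1` coefficients of the factor; the surplus term
  -- vanishes in the limit.
  have hlast : Tendsto (fun m : ℕ => (((b - a) / m : ℝ) : ℂ) * f b) atTop (𝓝 0) := by
    have h0 : Tendsto (fun m : ℕ => (((b - a) / m : ℝ) : ℂ)) atTop (𝓝 ((0 : ℝ) : ℂ)) :=
      (Complex.continuous_ofReal.tendsto 0).comp (tendsto_const_div_atTop_nhds_zero_nat (b - a))
    simpa using h0.mul_const (f b)
  have hmain : Tendsto (fun m : ℕ => (((b - a) / m : ℝ) : ℂ) *
      ∑ k ∈ Finset.range m, f (a + k * ((b - a) / m))) atTop (𝓝 (∫ t in a..b, f t)) := by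
    rw [Metric.tendsto_atTop]
    intro ε hε
    have huc := isCompact_Icc.uniformContinuousOn_of_continuous (hf.continuousOn (s := Icc a b))
    rw [Metric.uniformContinuousOn_iff] at huc
    obtain ⟨η, hη, huc⟩ := huc (ε / (b - a + 1)) (div_pos hε (by linarith))
    obtain ⟨N, hN⟩ := exists_nat_gt ((b - a) / η)
    refine ⟨N + 1, fun m hm => ?_⟩
    have hm0 : (0 : ℝ) < m := by exact_mod_cast (by omega : 0 < m)
    set h : ℝ := (b - a) / m with hh
    have h0 : 0 ≤ h := div_nonneg (by linarith) hm0.le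
    have hmh : m * h = b - a := by rw [hh]; field_simp
    have hhη : h < η := by
      have hNm : (N : ℝ) < m := by exact_mod_cast (by omega : N < m)
      rw [hh, div_lt_iff₀ hm0]
      rw [div_lt_iff₀ hη] at hN
      nlinarith
    have hint : ∀ u v, IntervalIntegrable f volume u v := fun u v => hf.intervalIntegrable u v
    have hsum := intervalIntegral.sum_integral_adjacent_intervals (f := f) (μ := volume)
      (a := fun k : ℕ => a + k * h) (n := m) fun k _ => hint _ _
    simp only [Nat.cast_zero, zero_mul, add_zero, hmh, add_sub_cancel] at hsum
    rw [← hsum, dist_eq_norm, Finset.mul_sum, ← Finset.sum_sub_distrib]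
    have hterm : ∀ k ∈ Finset.range m,
        ‖(h : ℂ) * f (a + k * h) - ∫ x in (a + k * h)..(a + (k + 1 : ℕ) * h), f x‖ ≤
          ε / (b - a + 1) * h := by
      intro k hk
      have hkm : (k : ℝ) + 1 ≤ m := by exact_mod_cast Finset.mem_range.1 hk
      have hlen : a + (k + 1 : ℕ) * h - (a + k * h) = h := by push_cast; ring
      have hc : (h : ℂ) * f (a + k * h) =
          ∫ _ in (a + k * h)..(a + (k + 1 : ℕ) * h), f (a + k * h) := by
        rw [intervalIntegral.integral_const, hlen, Complex.real_smul]
      rw [hc, ← intervalIntegral.integral_sub (by simp) (hint _ _)]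
      refine (intervalIntegral.norm_integral_le_of_norm_le_const fun x hx => ?_).trans
        (by rw [hlen, abs_of_nonneg h0])
      rw [uIoc_of_le (by linarith)] at hx
      have hk0 : (0 : ℝ) ≤ k * h := by positivity
      have hkh : (k + 1 : ℕ) * h ≤ m * h := by
        push_cast; exact mul_le_mul_of_nonneg_right hkm h0
      rw [← dist_eq_norm]
      refine (huc _ ⟨by linarith, by linarith [hx.1, hx.2]⟩ x
        ⟨by linarith [hx.1], by linarith [hx.2]⟩ ?_).le
      rw [Real.dist_eq, abs_sub_comm, abs_of_nonneg (by linarith [hx.1])]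
      linarith [hx.2]
    refine (norm_sum_le_of_le _ hterm).trans_lt ?_
    rw [Finset.sum_const, Finset.card_range, nsmul_eq_mul, mul_left_comm, hmh,
      div_mul_eq_mul_div, div_lt_iff₀ (by linarith)]
    nlinarith
  refine ((hmain.add hlast).congr' ?_).trans (by rw [add_zero])
  filter_upwards [eventually_gt_atTop 0] with m hm
  have hm0 : (m : ℝ) ≠ 0 := by exact_mod_cast hm.ne'
  rw [Finset.sum_range_succ, mul_add]
  congr 3
  field_simp
  ring

theorem differentiable_integral_expWave {g : ℝ → ℂ} (hg : Continuous g) (a b : ℝ) :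
    Differentiable ℂ fun z : ℂ => ∫ t in a..b, g t * expWave t z := by
  intro z₀
  set F' : ℂ → ℝ → ℂ := fun z t => g t * (expWave t z * (2 * Real.pi * Complex.I * t)) with hF'
  have hcont : Continuous fun p : ℂ × ℝ => F' p.1 p.2 := by
    simp only [hF', expWave]; fun_prop
  obtain ⟨C, hC⟩ := ((isCompact_closedBall z₀ 1).prod
    (isCompact_uIcc (a := a) (b := b))).exists_bound_of_continuousOn hcont.continuousOn
  have hc : ∀ z : ℂ, Continuous fun t : ℝ => g t * expWave t z := by
    intro z; unfold expWave; fun_prop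
  refine (intervalIntegral.hasDerivAt_integral_of_dominated_loc_of_deriv_le (F' := F')
    (bound := fun _ => C) (Metric.closedBall_mem_nhds z₀ one_pos)
    (.of_forall fun z => (hc z).aestronglyMeasurable) ((hc z₀).intervalIntegrable _ _) ?_ ?_
    intervalIntegrable_const ?_).2.differentiableAt
  · exact (hcont.comp (by fun_prop : Continuous fun t : ℝ => (z₀, t))).aestronglyMeasurable
  · exact .of_forall fun t ht z hz => hC (z, t) ⟨hz, uIoc_subset_uIcc ht⟩
  · refine .of_forall fun t _ z _ => ?_
    simp only [hF', expWave]
    refine HasDerivAt.const_mul (g t) (HasDerivAt.cexp ?_)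
    simpa only [mul_one] using (hasDerivAt_id' z).const_mul (2 * Real.pi * Complex.I * t)

theorem continuous_fourier_of_integrable {f : ℝ → ℂ} (hf : Integrable f) : Continuous (𝓕 f) :=
  VectorFourier.fourierIntegral_continuous Real.continuous_fourierChar
    (by fun_prop) hf

/-- Fourier inversion gives this on the real line, and the identity theorem carries it to the plane,
both sides being entire. -/
theorem IsAdmissible.eq_integral {α β : ℂ} {δ : ℝ} {F : ℂ → ℂ} (hδ : 0 < δ)
    (hF : IsAdmissible α β δ F) (z : ℂ) :
    F z = ∫ ξ in (-δ)..δ, 𝓕 (fun x : ℝ => F x) ξ * expWave ξ z := by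
  set f : ℝ → ℂ := fun x => F x with hf
  have hfc : Continuous f := hF.entire.continuous.comp Complex.continuous_ofReal
  have hgc : Continuous (𝓕 f) := continuous_fourier_of_integrable hF.integrable
  have hgi : Integrable (𝓕 f) := hgc.integrable_of_hasCompactSupport
    (HasCompactSupport.of_support_subset_isCompact isCompact_Icc hF.fourier_support)
  have hreal : ∀ x : ℝ, F x = ∫ ξ in (-δ)..δ, 𝓕 f ξ * expWave ξ x := by
    intro x
    rw [intervalIntegral.integral_of_le (by linarith), ← integral_Icc_eq_integral_Ioc,
      setIntegral_eq_integral_of_forall_compl_eq_zero]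
    · have := congrFun (hfc.fourierInv_fourier_eq hF.integrable hgi) x
      rw [fourierInv_eq_integral_expWave] at this
      exact this.symm.trans (integral_congr_ae (.of_forall fun t => mul_comm _ _))
    · intro ξ hξ
      have : 𝓕 f ξ = 0 := by
        by_contra h
        exact hξ (hF.fourier_support h)
      rw [this, zero_mul]
  have hfreq : ∃ᶠ w : ℂ in 𝓝[≠] 0, F w = ∫ ξ in (-δ)..δ, 𝓕 f ξ * expWave ξ w := by
    have ht : Tendsto (fun n : ℕ => (((1 : ℝ) / (n + 1) : ℝ) : ℂ)) atTop (𝓝[≠] 0) := by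
      refine tendsto_nhdsWithin_iff.2 ⟨?_, .of_forall fun n => ?_⟩
      · exact (Complex.continuous_ofReal.tendsto' 0 0 (by simp)).comp
          tendsto_one_div_add_atTop_nhds_zero_nat
      · have : (0 : ℝ) < 1 / (n + 1) := by positivity
        exact Complex.ofReal_ne_zero.2 this.ne'
    exact ht.frequently (.of_forall fun n => hreal _)
  exact congrFun (AnalyticOnNhd.eq_of_frequently_eq (𝕜 := ℂ)
    (fun w _ => hF.entire.analyticAt w)
    (fun w _ => (differentiable_integral_expWave hgc (-δ) δ).analyticAt w) hfreq) z

/-- This form absorbs the removable singularity and shows the spectrum `[-δ/2, δ/2]`; both entirety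
and the Riemann sum limit rest on it. -/
theorem sincKernel_eq_integral (δ : ℝ) (ω z : ℂ) :
    sincKernel δ ω z = ∫ t in (-(δ / 2))..(δ / 2), expWave t (z - conj ω) := by
  unfold sincKernel expWave
  split_ifs with h
  · simp [h]
  · have hz : z - conj ω ≠ 0 := sub_ne_zero.2 h
    have hc : 2 * (Real.pi : ℂ) * Complex.I * (z - conj ω) ≠ 0 := by
      simp [hz, Real.pi_ne_zero, Complex.I_ne_zero]
    have := integral_exp_mul_complex (a := -(δ / 2)) (b := δ / 2) hc
    have h2 : ∀ t : ℝ, 2 * (Real.pi : ℂ) * Complex.I * t * (z - conj ω) =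
      2 * Real.pi * Complex.I * (z - conj ω) * t := fun t => by ring
    simp only [h2]
    rw [this, Complex.sin]
    have hπ : (Real.pi : ℂ) ≠ 0 := by exact_mod_cast Real.pi_ne_zero
    have e1 : 2 * (Real.pi : ℂ) * Complex.I * (z - conj ω) * ((δ / 2 : ℝ) : ℂ) =
      Real.pi * δ * (z - conj ω) * Complex.I := by push_cast; ring
    have e2 : 2 * (Real.pi : ℂ) * Complex.I * (z - conj ω) * ((-(δ / 2) : ℝ) : ℂ) =
      -(Real.pi * δ * (z - conj ω)) * Complex.I := by push_cast; ring
    rw [e1, e2]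
    have hI := Complex.I_ne_zero
    field_simp
    rw [Complex.I_sq]
    ring

theorem differentiable_sincKernel (δ : ℝ) (ω : ℂ) : Differentiable ℂ (sincKernel δ ω) := by
  have h : sincKernel δ ω =
      fun z => ∫ t in (-(δ / 2))..(δ / 2), expWave t (-conj ω) * expWave t z := by
    ext z
    rw [sincKernel_eq_integral]
    simp only [← expWave_add_right, neg_add_eq_sub]
  rw [h]
  refine differentiable_integral_expWave ?_ _ _
  unfold expWave; fun_prop

theorem IsAdmissible.fourier_zero {α β : ℂ} {δ : ℝ} {F : ℂ → ℂ} (hF : IsAdmissible α β δ F) :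
    𝓕 (fun x : ℝ => F x) 0 = (lineIntegral F : ℂ) := by
  rw [fourier_eq_integral_expWave, lineIntegral, ← integral_complex_ofReal]
  refine integral_congr_ae (.of_forall fun t => ?_)
  simp only [neg_zero, expWave_zero, one_mul]
  exact Complex.ext rfl (by simp [hF.real_on_real])

/-! ### Discretisation: factoring the sampled function. -/

/-- The trigonometric polynomial whose coefficients are samples of the Fourier transform of `F`. -/
noncomputable def fourierSampleSum (F : ℂ → ℂ) (δ : ℝ) (n : ℕ) (z : ℂ) : ℂ :=
  ((δ / n : ℝ) : ℂ) * ∑ k ∈ Finset.range (2 * n + 1),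
    𝓕 (fun x : ℝ => F x) (((k : ℤ) - (n : ℤ) : ℤ) * (δ / n)) *
      expWave (((k : ℤ) - (n : ℤ) : ℤ) * (δ / n)) z

/-- The frequencies of the discretised kernel. -/
noncomputable def sampleFreq (δ : ℝ) (n j : ℕ) : ℝ := -(δ / 2) + j * (δ / n)

-- In the variable `expWave (δ / n) z` the sample sum becomes a polynomial after multiplication by
-- the `n`-th power. The `ε` supplies the strict positivity that `fejer_riesz` needs.
open Polynomial in
theorem IsAdmissible.exists_factor {α β : ℂ} {δ : ℝ} {F : ℂ → ℂ} (hδ : 0 < δ)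
    (hF : IsAdmissible α β δ F) {n : ℕ} (hn : 0 < n) {ε : ℝ} (hε : 0 < ε) :
    ∃ c : ℕ → ℂ,
      (∀ z : ℂ, (∑ j ∈ Finset.range (n + 1), c j * expWave (sampleFreq δ n j) z) *
        conj (∑ j ∈ Finset.range (n + 1), c j * expWave (sampleFreq δ n j) (conj z)) =
          fourierSampleSum F δ n z + ε) ∧
      ∑ j ∈ Finset.range (n + 1), ‖c j‖ ^ 2 = δ / n * lineIntegral F + ε := by
  have hn' : (0 : ℝ) < n := by exact_mod_cast hn
  set h : ℝ := δ / n with hh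
  have h0 : 0 < h := div_pos hδ hn'
  set f : ℝ → ℂ := fun x => F x with hf
  set p : ℂ[X] := (∑ k ∈ Finset.range (2 * n + 1),
    C ((h : ℂ) * 𝓕 f (((k : ℤ) - (n : ℤ) : ℤ) * h)) * X ^ k) + C (ε : ℂ) * X ^ n with hp
  have hdeg : p.natDegree ≤ 2 * n := by
    refine natDegree_add_le_of_degree_le (natDegree_sum_le_of_forall_le _ _ fun k hk => ?_) ?_
    · exact (natDegree_C_mul_X_pow_le _ _).trans (Nat.lt_succ_iff.1 (Finset.mem_range.1 hk))
    · exact (natDegree_C_mul_X_pow_le _ _).trans (by omega)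
  have heval : ∀ z : ℂ, p.eval (expWave h z) =
      expWave h z ^ n * (fourierSampleSum F δ n z + ε) := by
    intro z
    rw [hp, eval_add, eval_finsetSum, fourierSampleSum, mul_add, ← hh, Finset.mul_sum,
      Finset.mul_sum]
    simp only [eval_mul, eval_C, eval_pow, eval_X]
    congr 1
    · refine Finset.sum_congr rfl fun k _ => ?_
      have : expWave h z ^ k = expWave h z ^ n * expWave (((k : ℤ) - (n : ℤ) : ℤ) * h) z := by
        rw [← expWave_nat_mul, ← expWave_nat_mul, ← expWave_add]
        congr 1; push_cast; ring
      rw [this]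
      ring
    · ring
  have hpos : ∀ z : ℂ, ‖z‖ = 1 → ∃ r : ℝ, 0 < r ∧ p.eval z = r * z ^ n := by
    intro z hz
    -- Every point of the circle comes from a real argument, so positivity on the line suffices.
    have hzx : z = expWave h ((z.arg / (2 * Real.pi * h) : ℝ) : ℂ) := by
      have hπ := Real.pi_ne_zero
      conv_lhs => rw [← Complex.norm_mul_exp_arg_mul_I z, hz, Complex.ofReal_one, one_mul]
      rw [expWave]
      congr 1
      have h0' : (h : ℂ) ≠ 0 := by exact_mod_cast h0.ne'
      have hπ' : (Real.pi : ℂ) ≠ 0 := by exact_mod_cast hπ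
      push_cast
      field_simp
    obtain ⟨s, hs0, hs⟩ := sum_fourier_expWave_nonneg hF.integrable hF.real_on_real
      hF.nonneg_on_real hδ hF.fourier_support hn (z.arg / (2 * Real.pi * h))
    refine ⟨h * s + ε, by positivity, ?_⟩
    conv_lhs => rw [hzx]
    rw [heval, ← hzx, fourierSampleSum, hs, ← hh]
    push_cast
    ring
  obtain ⟨q, hq, hpq⟩ := fejer_riesz n p hdeg hpos
  -- The factor `expWave (-(δ / 2)) z` centres the frequencies on `[-δ/2, δ/2]`, and it cancels in
  -- the product with the conjugate.
  have hQ : ∀ z : ℂ, ∑ j ∈ Finset.range (n + 1), q.coeff j * expWave (sampleFreq δ n j) z =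
      expWave (-(δ / 2)) z * q.eval (expWave h z) := by
    intro z
    rw [eval_eq_sum_range' (Nat.lt_succ_iff.2 hq), Finset.mul_sum]
    refine Finset.sum_congr rfl fun j _ => ?_
    rw [sampleFreq, expWave_add, expWave_nat_mul]
    ring
  refine ⟨q.coeff, fun z => ?_, ?_⟩
  · rw [hQ, hQ, map_mul, conj_expWave, Complex.conj_conj, expWave_neg_right]
    have h1 := heval z
    have hw := expWave_ne_zero h z
    rw [hpq, eval_mul, eval_reflect_map_conj hq hw, ← expWave_neg_right, conj_expWave, map_neg,
      neg_neg] at h1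
    have hw2 := expWave_ne_zero (-(δ / 2)) z
    apply mul_left_cancel₀ (pow_ne_zero n hw)
    rw [← h1]
    field_simp
  -- The middle coefficient is the sum of squares on one side and, on the other, the sample at
  -- frequency zero, which is the integral of `F`.
  · have h1 := coeff_mul_reflect_map_conj n q
    rw [← hpq, hp, coeff_add, finsetSum_coeff] at h1
    simp only [coeff_C_mul_X_pow, if_true] at h1
    rw [Finset.sum_ite_eq, if_pos (Finset.mem_range.2 (by omega)), sub_self,
      Int.cast_zero, zero_mul, hF.fourier_zero] at h1
    exact_mod_cast h1.symm

/-- The discretised reproducing kernel. -/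
noncomputable def sampleKernel (δ : ℝ) (n : ℕ) (z : ℂ) : EuclideanSpace ℂ (Fin (n + 1)) :=
  WithLp.toLp 2 fun j => (Real.sqrt (δ / n) : ℂ) * conj (expWave (sampleFreq δ n j) z)

theorem inner_sampleKernel {δ : ℝ} (hδ : 0 < δ) (n : ℕ) (w z : ℂ) :
    inner ℂ (sampleKernel δ n w) (sampleKernel δ n z) =
      ((δ / n : ℝ) : ℂ) * ∑ j ∈ Finset.range (n + 1), expWave (sampleFreq δ n j) (w - conj z) := by
  have hs : ((Real.sqrt (δ / n) : ℝ) : ℂ) * (Real.sqrt (δ / n) : ℝ) = ((δ / n : ℝ) : ℂ) := by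
    rw [← Complex.ofReal_mul, Real.mul_self_sqrt (by positivity)]
  rw [PiLp.inner_apply, Finset.sum_range, Finset.mul_sum]
  refine Finset.sum_congr rfl fun j _ => ?_
  rw [RCLike.inner_apply]
  simp only [sampleKernel]
  rw [map_mul, Complex.conj_conj, Complex.conj_ofReal, conj_expWave, sub_eq_add_neg, expWave_add_right, ← hs]
  ring

/-- Dividing the coefficients by `√(δ / n)`, and giving the kernels that weight, keeps the
evaluations and makes the norm independent of `n`. -/
theorem IsAdmissible.exists_vector {α β : ℂ} {δ : ℝ} {F : ℂ → ℂ} (hδ : 0 < δ)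
    (hF : IsAdmissible α β δ F) {n : ℕ} (hn : 0 < n) {ε : ℝ} (hε : 0 < ε) :
    ∃ d : EuclideanSpace ℂ (Fin (n + 1)),
      (∀ z : ℂ, inner ℂ (sampleKernel δ n z) d * conj (inner ℂ (sampleKernel δ n (conj z)) d) =
        fourierSampleSum F δ n z + ((δ / n * ε : ℝ) : ℂ)) ∧
      ‖d‖ ^ 2 = lineIntegral F + ε := by
  have h0 : 0 < δ / n := div_pos hδ (by exact_mod_cast hn)
  obtain ⟨c, hc, hnorm⟩ := hF.exists_factor hδ hn (mul_pos h0 hε)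
  have hs : Real.sqrt (δ / n) ≠ 0 := (Real.sqrt_pos.2 h0).ne'
  have hs' : ((Real.sqrt (δ / n) : ℝ) : ℂ) ≠ 0 := by exact_mod_cast hs
  set d : EuclideanSpace ℂ (Fin (n + 1)) :=
    WithLp.toLp 2 fun j => c j / (Real.sqrt (δ / n) : ℂ) with hd
  have hin : ∀ z : ℂ, inner ℂ (sampleKernel δ n z) d =
      ∑ j ∈ Finset.range (n + 1), c j * expWave (sampleFreq δ n j) z := by
    intro z
    rw [PiLp.inner_apply, Finset.sum_range]
    refine Finset.sum_congr rfl fun j _ => ?_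
    rw [RCLike.inner_apply, sampleKernel, hd, map_mul, Complex.conj_conj, Complex.conj_ofReal]
    field_simp
  refine ⟨d, fun z => by rw [hin, hin, hc], ?_⟩
  have : ∀ j : Fin (n + 1), ‖d j‖ ^ 2 = ‖c j‖ ^ 2 / (δ / n) := by
    intro j
    rw [hd, norm_div, div_pow, Complex.norm_real, Real.norm_eq_abs, sq_abs, Real.sq_sqrt h0.le]
  rw [EuclideanSpace.norm_sq_eq, Finset.sum_congr rfl fun j _ => this j, ← Finset.sum_div,
    ← Finset.sum_range (fun j => ‖c j‖ ^ 2), hnorm]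
  field_simp

theorem tendsto_inner_sampleKernel {δ : ℝ} (hδ : 0 < δ) (w z : ℂ) :
    Tendsto (fun n : ℕ => inner ℂ (sampleKernel δ n w) (sampleKernel δ n z)) atTop
      (𝓝 (sincKernel δ z w)) := by
  rw [sincKernel_eq_integral]
  have hc : Continuous fun t : ℝ => expWave t (w - conj z) := by unfold expWave; fun_prop
  have h := tendsto_riemann_sum hc (a := -(δ / 2)) (b := δ / 2) (by linarith)
  refine h.congr fun n => ?_
  rw [inner_sampleKernel hδ]
  simp only [sampleFreq, sub_neg_eq_add, add_halves]

theorem IsAdmissible.tendsto_fourierSampleSum {α β : ℂ} {δ : ℝ} {F : ℂ → ℂ} (hδ : 0 < δ)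
    (hF : IsAdmissible α β δ F) (z : ℂ) :
    Tendsto (fun n : ℕ => fourierSampleSum F δ n z) atTop (𝓝 (F z)) := by
  rw [hF.eq_integral hδ]
  have hc : Continuous fun t : ℝ => 𝓕 (fun x : ℝ => F x) t * expWave t z := by
    refine (continuous_fourier_of_integrable hF.integrable).mul ?_
    unfold expWave; fun_prop
  have h := (tendsto_riemann_sum hc (a := -δ) (b := δ) (by linarith)).comp
    (tendsto_id.const_mul_atTop' (two_pos : 0 < 2) : Tendsto (fun n : ℕ => 2 * n) atTop atTop)
  refine h.congr' ?_
  filter_upwards [eventually_gt_atTop 0] with n hn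
  have hn' : (n : ℝ) ≠ 0 := by exact_mod_cast hn.ne'
  have hstep : (δ - -δ) / ((2 * n : ℕ) : ℝ) = δ / n := by push_cast; field_simp; ring
  have hpt : ∀ k : ℕ, -δ + k * (δ / n) = (((k : ℤ) - (n : ℤ) : ℤ) : ℝ) * (δ / n) := by
    intro k; push_cast; field_simp; ring
  simp only [Function.comp_apply, fourierSampleSum, hstep, hpt]

/-! ### Passage to the limit. -/

/-- The squared length of `l₁ K(α, ·) + l₂ K(conj α, ·)` in the Paley–Wiener space. -/
noncomputable def gramForm (δ : ℝ) (α l₁ l₂ : ℂ) : ℝ :=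
  (conj l₁ * l₁ * sincKernel δ α α + conj l₁ * l₂ * sincKernel δ (conj α) α +
    conj l₂ * l₁ * sincKernel δ α (conj α) +
    conj l₂ * l₂ * sincKernel δ (conj α) (conj α)).re

/-- For admissible `F` there are `a, b` with `a * conj b = β` such that, for all `l₁, l₂`, the
expression which for `F = U U*`, `U α = a` and `U (conj α) = b` would be the squared distance from `U`
to `l₁ K(α, ·) + l₂ K(conj α, ·)` is nonnegative, and vanishes only if `F` is the square of the latter
function. -/
theorem IsAdmissible.exists_values {α β : ℂ} {δ : ℝ} {F : ℂ → ℂ} (hδ : 0 < δ)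
    (hF : IsAdmissible α β δ F) :
    ∃ a b : ℂ, a * conj b = β ∧ ∀ l₁ l₂ : ℂ,
      0 ≤ lineIntegral F - 2 * (conj l₁ * a + conj l₂ * b).re + gramForm δ α l₁ l₂ ∧
      (lineIntegral F - 2 * (conj l₁ * a + conj l₂ * b).re + gramForm δ α l₁ l₂ = 0 → ∀ z : ℂ,
        F z = (l₁ * sincKernel δ α z + l₂ * sincKernel δ (conj α) z) *
          conj (l₁ * sincKernel δ α (conj z) + l₂ * sincKernel δ (conj α) (conj z))) := by
  have hex : ∀ m : ℕ, ∃ d : EuclideanSpace ℂ (Fin (m + 1 + 1)),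
      (∀ z : ℂ, inner ℂ (sampleKernel δ (m + 1) z) d *
        conj (inner ℂ (sampleKernel δ (m + 1) (conj z)) d) =
        fourierSampleSum F δ (m + 1) z +
          ((δ / (m + 1 : ℕ) * ((1 : ℝ) / (m + 1)) : ℝ) : ℂ)) ∧
      ‖d‖ ^ 2 = lineIntegral F + 1 / (m + 1) := fun m =>
    hF.exists_vector hδ m.succ_pos (by positivity)
  choose d hd hnorm using hex
  set k : ∀ (m : ℕ), ℂ → EuclideanSpace ℂ (Fin (m + 1 + 1)) :=
    fun m z => sampleKernel δ (m + 1) z with hk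
  have hkk : ∀ w z : ℂ, Tendsto (fun m => inner ℂ (k m w) (k m z)) atTop
      (𝓝 (sincKernel δ z w)) := fun w z =>
    (tendsto_inner_sampleKernel hδ w z).comp (tendsto_add_atTop_nat 1)
  have hprod : ∀ z : ℂ, Tendsto (fun m => inner ℂ (k m z) (d m) *
      conj (inner ℂ (k m (conj z)) (d m))) atTop (𝓝 (F z)) := by
    intro z
    simp only [hk, hd]
    have h1 := (hF.tendsto_fourierSampleSum hδ z).comp (tendsto_add_atTop_nat 1)
    have h2 : Tendsto (fun m : ℕ => (((δ / (m + 1 : ℕ) * ((1 : ℝ) / (m + 1)) : ℝ) : ℂ))) atTop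
        (𝓝 0) := by
      refine (Complex.continuous_ofReal.tendsto' 0 0 (by simp)).comp ?_
      simpa using ((tendsto_const_div_atTop_nhds_zero_nat δ).comp (tendsto_add_atTop_nat 1)).mul
        (tendsto_one_div_add_atTop_nhds_zero_nat (𝕜 := ℝ))
    simpa using h1.add h2
  have hdn : Tendsto (fun m => ‖d m‖ ^ 2) atTop (𝓝 (lineIntegral F)) := by
    simp only [hnorm]
    simpa using tendsto_one_div_add_atTop_nhds_zero_nat.const_add (lineIntegral F)
  have hkn : ∀ z : ℂ, Tendsto (fun m => ‖k m z‖ ^ 2) atTop (𝓝 (sincKernel δ z z).re) := by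
    intro z
    refine ((Complex.continuous_re.tendsto _).comp (hkk z z)).congr fun m => ?_
    exact inner_self_eq_norm_sq (𝕜 := ℂ) (k m z)
  -- Only the products of evaluations are known to converge; Cauchy–Schwarz bounds the evaluations
  -- themselves, so a subsequence can be extracted.
  have hbdd : ∀ z : ℂ, ∃ C, ∀ m, ‖inner ℂ (k m z) (d m)‖ ≤ C := by
    intro z
    obtain ⟨C₁, hC₁⟩ := (hkn z).bddAbove_range
    obtain ⟨C₂, hC₂⟩ := hdn.bddAbove_range
    refine ⟨(C₁ + C₂) / 2, fun m => (norm_inner_le_norm _ _).trans ?_⟩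
    have h1 := hC₁ (mem_range_self m)
    have h2 := hC₂ (mem_range_self m)
    nlinarith [sq_nonneg (‖k m z‖ - ‖d m‖)]
  obtain ⟨C₁, hC₁⟩ := hbdd α
  obtain ⟨C₂, hC₂⟩ := hbdd (conj α)
  obtain ⟨⟨a, b⟩, -, φ, hφ, hab⟩ := tendsto_subseq_of_bounded
    ((Metric.isBounded_closedBall (x := (0 : ℂ)) (r := C₁)).prod
      (Metric.isBounded_closedBall (x := (0 : ℂ)) (r := C₂)))
    (x := fun m => (inner ℂ (k m α) (d m), inner ℂ (k m (conj α)) (d m)))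
    (fun m => ⟨by simpa using hC₁ m, by simpa using hC₂ m⟩)
  have ha : Tendsto (fun m => inner ℂ (k (φ m) α) (d (φ m))) atTop (𝓝 a) :=
    (continuous_fst.tendsto _).comp hab
  have hb : Tendsto (fun m => inner ℂ (k (φ m) (conj α)) (d (φ m))) atTop (𝓝 b) :=
    (continuous_snd.tendsto _).comp hab
  have hφt := hφ.tendsto_atTop
  have hconj : ∀ {u : ℕ → ℂ} {c : ℂ}, Tendsto u atTop (𝓝 c) →
      Tendsto (fun m => conj (u m)) atTop (𝓝 (conj c)) := fun h =>
    (Complex.continuous_conj.tendsto _).comp h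
  refine ⟨a, b, ?_, fun l₁ l₂ => ?_⟩
  · rw [← hF.interpolates]
    exact tendsto_nhds_unique (ha.mul (hconj hb)) ((hprod α).comp hφt)
  -- The residual of `d` against a combination of the two sampled kernels; the limit of its squared
  -- norm is the expression in the statement.
  set e : ∀ m, EuclideanSpace ℂ (Fin (φ m + 1 + 1)) :=
    fun m => d (φ m) - (l₁ • k (φ m) α + l₂ • k (φ m) (conj α)) with he
  have hen : Tendsto (fun m => ‖e m‖ ^ 2) atTop
      (𝓝 (lineIntegral F - 2 * (conj l₁ * a + conj l₂ * b).re + gramForm δ α l₁ l₂)) := by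
    have h1 : Tendsto (fun m => (conj l₁ * inner ℂ (k (φ m) α) (d (φ m)) +
        conj l₂ * inner ℂ (k (φ m) (conj α)) (d (φ m))).re) atTop
        (𝓝 (conj l₁ * a + conj l₂ * b).re) :=
      (Complex.continuous_re.tendsto _).comp ((ha.const_mul _).add (hb.const_mul _))
    have h2 := (Complex.continuous_re.tendsto _).comp
      ((((((hkk α α).comp hφt).const_mul (conj l₁ * l₁)).add
        (((hkk α (conj α)).comp hφt).const_mul (conj l₁ * l₂))).add
        (((hkk (conj α) α).comp hφt).const_mul (conj l₂ * l₁))).add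
        (((hkk (conj α) (conj α)).comp hφt).const_mul (conj l₂ * l₂)))
    refine (((hdn.comp hφt).sub (h1.const_mul 2)).add h2).congr fun m => ?_
    simp only [he, Function.comp_apply]
    rw [norm_sub_sq (𝕜 := ℂ), inner_re_symm,
      ← inner_self_eq_norm_sq (𝕜 := ℂ) (l₁ • k (φ m) α + l₂ • k (φ m) (conj α))]
    simp only [inner_add_left, inner_add_right, inner_smul_left, inner_smul_right,
      RCLike.re_to_complex, Complex.add_re, mul_add]
    ring_nf
  refine ⟨ge_of_tendsto' hen fun m => by positivity, fun hzero => ?_⟩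
  rw [hzero] at hen
  have hQ : ∀ z : ℂ, Tendsto (fun m => inner ℂ (k (φ m) z) (d (φ m))) atTop
      (𝓝 (l₁ * sincKernel δ α z + l₂ * sincKernel δ (conj α) z)) := by
    intro z
    -- A vanishing residual is invisible to every evaluation, since kernel norms stay bounded.
    have h1 : Tendsto (fun m => inner ℂ (k (φ m) z) (e m)) atTop (𝓝 0) := by
      rw [tendsto_zero_iff_norm_tendsto_zero]
      have h2 : Tendsto (fun m => Real.sqrt (‖k (φ m) z‖ ^ 2 * ‖e m‖ ^ 2)) atTop (𝓝 0) := by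
        have := (Real.continuous_sqrt.tendsto _).comp (((hkn z).comp hφt).mul hen)
        simpa only [mul_zero, Real.sqrt_zero, Function.comp_def] using this
      refine squeeze_zero (fun m => norm_nonneg _) (fun m => ?_) h2
      rw [← mul_pow, Real.sqrt_sq (by positivity)]
      exact norm_inner_le_norm _ _
    have h3 := h1.add ((((hkk z α).comp hφt).const_mul l₁).add
      (((hkk z (conj α)).comp hφt).const_mul l₂))
    rw [zero_add] at h3
    refine h3.congr fun m => ?_
    simp only [he, Function.comp_apply, inner_sub_right, inner_add_right, inner_smul_right]
    ring
  intro z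
  exact tendsto_nhds_unique ((hprod z).comp hφt) ((hQ z).mul (hconj (hQ (conj z))))

/-! ### Squares of kernel combinations are admissible. -/

theorem conj_sincKernel_conj (δ : ℝ) (ω z : ℂ) :
    conj (sincKernel δ ω (conj z)) = sincKernel δ (conj ω) z := by
  unfold sincKernel
  by_cases h : z = ω
  · simp [h]
  · have h' : conj z ≠ conj ω := fun hc => h ((starRingEnd ℂ).injective hc)
    rw [if_neg h', if_neg (by rwa [Complex.conj_conj]), map_div₀, ← Complex.sin_conj]
    simp

/-- `∑ lᵢ exp (-2 π i ωᵢ t)`, cut off to the interval on which the kernel's spectrum lives. -/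
noncomputable def kernelSpectrum (δ : ℝ) (α l₁ l₂ : ℂ) : ℝ → ℂ :=
  (Icc (-(δ / 2)) (δ / 2)).indicator fun t => l₁ * expWave t (-conj α) + l₂ * expWave t (-α)

section
variable (δ : ℝ) (α l₁ l₂ : ℂ)

theorem continuous_spectrum_formula :
    Continuous fun t : ℝ => l₁ * expWave t (-conj α) + l₂ * expWave t (-α) := by
  unfold expWave; fun_prop

theorem integrable_kernelSpectrum : Integrable (kernelSpectrum δ α l₁ l₂) :=
  ((continuous_spectrum_formula α l₁ l₂).integrableOn_Icc).integrable_indicator measurableSet_Icc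

theorem exists_norm_kernelSpectrum_le : ∃ C, ∀ t, ‖kernelSpectrum δ α l₁ l₂ t‖ ≤ C := by
  obtain ⟨C, hC⟩ := (isCompact_Icc (a := -(δ / 2)) (b := δ / 2)).exists_bound_of_continuousOn
    (continuous_spectrum_formula α l₁ l₂).continuousOn
  refine ⟨max C 0, fun t => ?_⟩
  by_cases ht : t ∈ Icc (-(δ / 2)) (δ / 2)
  · rw [kernelSpectrum, indicator_of_mem ht]
    exact (hC t ht).trans (le_max_left _ _)
  · rw [kernelSpectrum, indicator_of_notMem ht, norm_zero]
    exact le_max_right _ _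

theorem continuousAt_kernelSpectrum {t : ℝ} (h₁ : t ≠ -(δ / 2)) (h₂ : t ≠ δ / 2) :
    ContinuousAt (kernelSpectrum δ α l₁ l₂) t := by
  by_cases ht : t ∈ Icc (-(δ / 2)) (δ / 2)
  · have hmem : Icc (-(δ / 2)) (δ / 2) ∈ 𝓝 t :=
      Icc_mem_nhds (lt_of_le_of_ne ht.1 h₁.symm) (lt_of_le_of_ne ht.2 h₂)
    refine (continuous_spectrum_formula α l₁ l₂).continuousAt.congr ?_
    filter_upwards [hmem] with s hs
    rw [kernelSpectrum, indicator_of_mem hs]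
  · refine (continuousAt_const (y := (0 : ℂ))).congr ?_
    filter_upwards [isClosed_Icc.isOpen_compl.mem_nhds ht] with s hs
    rw [kernelSpectrum, indicator_of_notMem hs]

/-- The autocorrelation of `kernelSpectrum`. -/
noncomputable def spectrumAutocorrelation (ξ : ℝ) : ℂ :=
  ∫ t, kernelSpectrum δ α l₁ l₂ t * conj (kernelSpectrum δ α l₁ l₂ (t - ξ))

/-- Dominated convergence applies because the cut-off spectrum jumps at two points only. Continuity
makes the later Fourier inversion hold at every frequency, as the support condition requires. -/
theorem continuous_spectrumAutocorrelation :
    Continuous (spectrumAutocorrelation δ α l₁ l₂) := by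
  obtain ⟨C, hC⟩ := exists_norm_kernelSpectrum_le δ α l₁ l₂
  have hg := integrable_kernelSpectrum δ α l₁ l₂
  refine continuous_iff_continuousAt.2 fun ξ₀ => ?_
  refine continuousAt_of_dominated (bound := fun t => ‖kernelSpectrum δ α l₁ l₂ t‖ * C)
    (.of_forall fun ξ => ?_) (.of_forall fun ξ => .of_forall fun t => ?_) (hg.norm.mul_const C) ?_
  · exact hg.aestronglyMeasurable.mul
      (Complex.continuous_conj.comp_aestronglyMeasurable (hg.comp_sub_right ξ).aestronglyMeasurable)
  · rw [norm_mul, RCLike.norm_conj]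
    exact mul_le_mul_of_nonneg_left (hC _) (norm_nonneg _)
  · have h1 : ∀ᵐ t : ℝ, t ≠ -(δ / 2) + ξ₀ := by simp [ae_iff]
    have h2 : ∀ᵐ t : ℝ, t ≠ δ / 2 + ξ₀ := by simp [ae_iff]
    filter_upwards [h1, h2] with t ht1 ht2
    refine continuousAt_const.mul (Complex.continuous_conj.continuousAt.comp ?_)
    have hc := continuousAt_kernelSpectrum δ α l₁ l₂ (t := t - ξ₀)
      (fun h => ht1 (by linarith)) (fun h => ht2 (by linarith))
    exact ContinuousAt.comp (f := fun ξ => t - ξ) (x := ξ₀) hc (by fun_prop)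

theorem spectrumAutocorrelation_eq_zero {ξ : ℝ} (hξ : ξ ∉ Icc (-δ) δ) :
    spectrumAutocorrelation δ α l₁ l₂ ξ = 0 := by
  rw [spectrumAutocorrelation]
  refine integral_eq_zero_of_ae (.of_forall fun t => ?_)
  simp only [Pi.zero_apply]
  by_cases ht : t ∈ Icc (-(δ / 2)) (δ / 2)
  · have h' : t - ξ ∉ Icc (-(δ / 2)) (δ / 2) := fun h =>
      hξ ⟨by linarith [ht.1, h.2], by linarith [ht.2, h.1]⟩
    rw [kernelSpectrum, indicator_of_notMem h', map_zero, mul_zero]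
  · rw [kernelSpectrum, indicator_of_notMem ht, zero_mul]

theorem integral_kernelSpectrum_mul {δ : ℝ} (hδ : 0 ≤ δ) (f : ℝ → ℂ) :
    ∫ t, kernelSpectrum δ α l₁ l₂ t * f t =
      ∫ t in (-(δ / 2))..(δ / 2), (l₁ * expWave t (-conj α) + l₂ * expWave t (-α)) * f t := by
  rw [intervalIntegral.integral_of_le (by linarith), ← integral_Icc_eq_integral_Ioc,
    ← integral_indicator measurableSet_Icc]
  refine integral_congr_ae (.of_forall fun t => ?_)
  by_cases ht : t ∈ Icc (-(δ / 2)) (δ / 2)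
  · simp only [kernelSpectrum, indicator_of_mem ht]
  · simp only [kernelSpectrum, indicator_of_notMem ht, zero_mul]

theorem fourierInv_kernelSpectrum {δ : ℝ} (hδ : 0 ≤ δ) (x : ℝ) :
    𝓕⁻ (kernelSpectrum δ α l₁ l₂) x = l₁ * sincKernel δ α x + l₂ * sincKernel δ (conj α) x := by
  have hc : ∀ w : ℂ, IntervalIntegrable (fun t : ℝ => expWave t w) volume (-(δ / 2)) (δ / 2) :=
    fun w => Continuous.intervalIntegrable (by unfold expWave; fun_prop) _ _
  rw [fourierInv_eq_integral_expWave]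
  simp only [mul_comm (expWave _ _) (kernelSpectrum _ _ _ _ _)]
  rw [integral_kernelSpectrum_mul α l₁ l₂ hδ, sincKernel_eq_integral, sincKernel_eq_integral,
    ← intervalIntegral.integral_const_mul, ← intervalIntegral.integral_const_mul,
    ← intervalIntegral.integral_add ((hc _).const_mul _) ((hc _).const_mul _)]
  refine intervalIntegral.integral_congr fun t _ => ?_
  simp only [sub_eq_add_neg, expWave_add_right, Complex.conj_conj]
  ring

/-- At zero the autocorrelation is the squared `L²` norm of the spectrum, and its four cross terms
integrate to kernel values. -/
theorem spectrumAutocorrelation_zero {δ : ℝ} (hδ : 0 ≤ δ) :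
    (spectrumAutocorrelation δ α l₁ l₂ 0).re = gramForm δ α l₁ l₂ := by
  have hc : ∀ w : ℂ, IntervalIntegrable (fun t : ℝ => expWave t w) volume (-(δ / 2)) (δ / 2) :=
    fun w => Continuous.intervalIntegrable (by unfold expWave; fun_prop) _ _
  rw [spectrumAutocorrelation, integral_kernelSpectrum_mul α l₁ l₂ hδ, gramForm]
  simp only [sincKernel_eq_integral]
  simp only [← intervalIntegral.integral_const_mul]
  rw [← intervalIntegral.integral_add ((hc _).const_mul _) ((hc _).const_mul _),
    ← intervalIntegral.integral_add (((hc _).const_mul _).add ((hc _).const_mul _))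
      ((hc _).const_mul _),
    ← intervalIntegral.integral_add ((((hc _).const_mul _).add ((hc _).const_mul _)).add
      ((hc _).const_mul _)) ((hc _).const_mul _)]
  congr 1
  refine intervalIntegral.integral_congr fun t ht => ?_
  rw [uIcc_of_le (by linarith)] at ht
  simp only [sub_zero, kernelSpectrum, indicator_of_mem ht]
  simp only [sub_eq_add_neg, expWave_add_right, Complex.conj_conj, map_add, map_mul, conj_expWave,
    map_neg, neg_neg]
  ring

theorem integrable_conj_comp_neg {g : ℝ → ℂ} (hg : Integrable g) :
    Integrable fun t => conj (g (-t)) :=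
  (Complex.conjCLE : ℂ →L[ℝ] ℂ).integrable_comp hg.comp_neg

theorem spectrumAutocorrelation_eq_convolution :
    spectrumAutocorrelation δ α l₁ l₂ =
      convolution (kernelSpectrum δ α l₁ l₂) (fun t => conj (kernelSpectrum δ α l₁ l₂ (-t)))
        (ContinuousLinearMap.mul ℂ ℂ) := by
  ext ξ
  rw [convolution_mul, spectrumAutocorrelation]
  simp only [neg_sub]

theorem integrable_spectrumAutocorrelation :
    Integrable (spectrumAutocorrelation δ α l₁ l₂) := by
  rw [spectrumAutocorrelation_eq_convolution]
  have hg := integrable_kernelSpectrum δ α l₁ l₂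
  exact hg.integrable_convolution _ (integrable_conj_comp_neg hg)

theorem fourierInv_conj_comp_neg (g : ℝ → ℂ) (x : ℝ) :
    𝓕⁻ (fun t => conj (g (-t))) x = conj (𝓕⁻ g x) := by
  rw [fourierInv_eq_integral_expWave, fourierInv_eq_integral_expWave, ← integral_conj,
    ← integral_neg_eq_self]
  refine integral_congr_ae (.of_forall fun t => ?_)
  simp only [neg_neg, map_mul, conj_expWave, expWave_neg, Complex.conj_ofReal]

theorem fourierInv_spectrumAutocorrelation (x : ℝ) :
    𝓕⁻ (spectrumAutocorrelation δ α l₁ l₂) x =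
      𝓕⁻ (kernelSpectrum δ α l₁ l₂) x * conj (𝓕⁻ (kernelSpectrum δ α l₁ l₂) x) := by
  have hg := integrable_kernelSpectrum δ α l₁ l₂
  rw [← fourierInv_conj_comp_neg, spectrumAutocorrelation_eq_convolution]
  simp only [Real.fourierInv_eq_fourier_neg]
  exact Real.fourier_mul_convolution_eq hg (integrable_conj_comp_neg hg) (-x)

/-- The entire function `U U*` with `U = l₁ K(α, ·) + l₂ K(conj α, ·)`. -/
noncomputable def kernelSquare (z : ℂ) : ℂ :=
  (l₁ * sincKernel δ α z + l₂ * sincKernel δ (conj α) z) *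
    conj (l₁ * sincKernel δ α (conj z) + l₂ * sincKernel δ (conj α) (conj z))

theorem differentiable_kernelSquare : Differentiable ℂ (kernelSquare δ α l₁ l₂) := by
  have h : kernelSquare δ α l₁ l₂ = fun z =>
      (l₁ * sincKernel δ α z + l₂ * sincKernel δ (conj α) z) *
        (conj l₁ * sincKernel δ (conj α) z + conj l₂ * sincKernel δ α z) := by
    ext z
    simp only [kernelSquare, map_add, map_mul, conj_sincKernel_conj, Complex.conj_conj]
  rw [h]
  exact (((differentiable_sincKernel δ α).const_mul l₁).add
    ((differentiable_sincKernel δ (conj α)).const_mul l₂)).mul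
    (((differentiable_sincKernel δ (conj α)).const_mul _).add
    ((differentiable_sincKernel δ α).const_mul _))

theorem kernelSquare_ofReal (x : ℝ) : kernelSquare δ α l₁ l₂ x =
    ((‖l₁ * sincKernel δ α x + l₂ * sincKernel δ (conj α) x‖ ^ 2 : ℝ) : ℂ) := by
  rw [kernelSquare, Complex.conj_ofReal, Complex.mul_conj, Complex.normSq_eq_norm_sq]

/-- The sine is bounded on horizontal lines, and the denominator has no real zero for nonreal `ω`.
-/
theorem exists_norm_sincKernel_sq_le {ω : ℂ} (hω : ω.im ≠ 0) :
    ∃ C, ∀ x : ℝ, ‖sincKernel δ ω x‖ ^ 2 ≤ C * ((x - ω.re) ^ 2 + ω.im ^ 2)⁻¹ := by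
  refine ⟨(Real.cosh (Real.pi * δ * ω.im) / Real.pi) ^ 2, fun x => ?_⟩
  have hne : (x : ℂ) ≠ conj ω := by
    intro h
    have := congrArg Complex.im h
    simp at this
    exact hω this
  have hnorm : ‖(x : ℂ) - conj ω‖ ^ 2 = (x - ω.re) ^ 2 + ω.im ^ 2 := by
    rw [← Complex.normSq_eq_norm_sq, Complex.normSq_apply]
    simp
    ring
  have hsin : ‖Complex.sin (Real.pi * δ * (x - conj ω))‖ ≤ Real.cosh (Real.pi * δ * ω.im) := by
    have him : (Real.pi * δ * (x - conj ω) : ℂ).im = Real.pi * δ * ω.im := by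
      simp [← Complex.ofReal_mul]
    rw [Complex.sin, ← him, Real.cosh_eq, norm_div, norm_mul, Complex.norm_I, mul_one,
      Complex.norm_two]
    gcongr
    refine (norm_sub_le _ _).trans (le_of_eq ?_)
    rw [Complex.norm_exp, Complex.norm_exp]
    simp
  rw [sincKernel, if_neg hne, norm_div, div_pow, norm_mul, mul_pow, hnorm, Complex.norm_real,
    Real.norm_of_nonneg Real.pi_pos.le, div_pow]
  have hpos : 0 < (x - ω.re) ^ 2 + ω.im ^ 2 := by positivity
  rw [← div_eq_mul_inv, div_div]
  gcongr

theorem integrable_inv_sub_sq_add_sq (a : ℝ) {b : ℝ} (hb : b ≠ 0) :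
    Integrable fun x : ℝ => ((x - a) ^ 2 + b ^ 2)⁻¹ := by
  have h := ((integrable_inv_one_add_sq.comp_div hb).comp_sub_right a).const_mul (b ^ 2)⁻¹
  refine h.congr (.of_forall fun x => ?_)
  simp only
  rw [← mul_inv]
  congr 1
  field_simp
  ring

variable {α} in
theorem integrable_kernelSquare (hα : α.im ≠ 0) :
    Integrable fun x : ℝ => kernelSquare δ α l₁ l₂ x := by
  obtain ⟨C₁, hC₁⟩ := exists_norm_sincKernel_sq_le δ hα
  obtain ⟨C₂, hC₂⟩ := exists_norm_sincKernel_sq_le δ (ω := conj α) (by simpa using hα)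
  have hi := (integrable_inv_sub_sq_add_sq α.re hα).const_mul
    (2 * ‖l₁‖ ^ 2 * C₁ + 2 * ‖l₂‖ ^ 2 * C₂)
  refine hi.mono' ((differentiable_kernelSquare δ α l₁ l₂).continuous.comp
    Complex.continuous_ofReal).aestronglyMeasurable (.of_forall fun x => ?_)
  have h₁ := hC₁ x
  have h₂ := hC₂ x
  rw [Complex.conj_re, Complex.conj_im, neg_sq] at h₂
  rw [kernelSquare_ofReal, Complex.norm_real, Real.norm_of_nonneg (by positivity)]
  have hle : ‖l₁ * sincKernel δ α x + l₂ * sincKernel δ (conj α) x‖ ≤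
      ‖l₁‖ * ‖sincKernel δ α x‖ + ‖l₂‖ * ‖sincKernel δ (conj α) x‖ := by
    refine (norm_add_le _ _).trans (by rw [norm_mul, norm_mul])
  have e₁ := mul_le_mul_of_nonneg_left h₁ (sq_nonneg ‖l₁‖)
  have e₂ := mul_le_mul_of_nonneg_left h₂ (sq_nonneg ‖l₂‖)
  have hsq := pow_le_pow_left₀ (norm_nonneg _) hle 2
  nlinarith [sq_nonneg (‖l₁‖ * ‖sincKernel δ α x‖ - ‖l₂‖ * ‖sincKernel δ (conj α) x‖)]

-- By the convolution theorem `U U*` is the inverse transform of the autocorrelation. Inverting back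
-- needs an integrable transform, which is `U U*` at `-x`.
variable {δ α} in
theorem fourier_kernelSquare (hδ : 0 ≤ δ) (hα : α.im ≠ 0) :
    𝓕 (fun x : ℝ => kernelSquare δ α l₁ l₂ x) = spectrumAutocorrelation δ α l₁ l₂ := by
  have h : (fun x : ℝ => kernelSquare δ α l₁ l₂ x) =
      𝓕⁻ (spectrumAutocorrelation δ α l₁ l₂) := by
    ext x
    rw [fourierInv_spectrumAutocorrelation, fourierInv_kernelSpectrum _ _ _ hδ, kernelSquare,
      Complex.conj_ofReal]
  have hi : Integrable (𝓕 (spectrumAutocorrelation δ α l₁ l₂)) := by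
    refine (integrable_kernelSquare δ l₁ l₂ hα).comp_neg.congr (.of_forall fun x => ?_)
    simp only
    rw [congrFun h (-x), Real.fourierInv_eq_fourier_neg, neg_neg]
  rw [h]
  exact (continuous_spectrumAutocorrelation δ α l₁ l₂).fourier_fourierInv_eq
    (integrable_spectrumAutocorrelation δ α l₁ l₂) hi

variable {δ α} in
theorem isAdmissible_kernelSquare (hδ : 0 ≤ δ) (hα : α.im ≠ 0) :
    IsAdmissible α (kernelSquare δ α l₁ l₂ α) δ (kernelSquare δ α l₁ l₂) where
  entire := differentiable_kernelSquare δ α l₁ l₂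
  real_on_real x := by rw [kernelSquare_ofReal, Complex.ofReal_im]
  nonneg_on_real x := by rw [kernelSquare_ofReal, Complex.ofReal_re]; positivity
  integrable := integrable_kernelSquare δ l₁ l₂ hα
  interpolates := rfl
  fourier_support ξ hξ := by
    by_contra h
    rw [fourier_kernelSquare l₁ l₂ hδ hα] at hξ
    exact hξ (spectrumAutocorrelation_eq_zero δ α l₁ l₂ h)

variable {δ α} in
theorem lineIntegral_kernelSquare (hδ : 0 ≤ δ) (hα : α.im ≠ 0) :
    lineIntegral (kernelSquare δ α l₁ l₂) = gramForm δ α l₁ l₂ := by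
  rw [← spectrumAutocorrelation_zero α l₁ l₂ hδ, ← fourier_kernelSquare l₁ l₂ hδ hα,
    (isAdmissible_kernelSquare l₁ l₂ hδ hα).fourier_zero, Complex.ofReal_re]

end

/-! ### Two-point interpolation and the closed formula. -/

/-- The value `K(α, α)` of the kernel, for `y = Im α`. -/
noncomputable def kernelDiag (δ y : ℝ) : ℝ := Real.sinh (2 * Real.pi * δ * y) / (2 * Real.pi * y)

/-- Amounts to `t < sinh t` for `t > 0`; it makes the Gram matrix positive definite. -/
theorem lt_kernelDiag {δ y : ℝ} (hδ : 0 < δ) (hy : 0 < y) : δ < kernelDiag δ y := by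
  have hπ := Real.pi_pos
  rw [kernelDiag, lt_div_iff₀ (by positivity)]
  calc δ * (2 * Real.pi * y) = 2 * Real.pi * δ * y := by ring
    _ < _ := Real.self_lt_sinh_iff.2 (by positivity)

theorem sincKernel_self (δ : ℝ) {α : ℂ} (hα : α.im ≠ 0) :
    sincKernel δ α α = kernelDiag δ α.im := by
  have hne : α ≠ conj α := fun h => hα (Complex.conj_eq_iff_im.1 h.symm)
  have hI := Complex.I_ne_zero
  have hπ : (Real.pi : ℂ) ≠ 0 := by exact_mod_cast Real.pi_ne_zero
  have hα' : (α.im : ℂ) ≠ 0 := by exact_mod_cast hα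
  rw [sincKernel, if_neg hne, Complex.sub_conj, ← mul_assoc, Complex.sin_mul_I, kernelDiag]
  push_cast
  rw [show (Real.pi : ℂ) * δ * (2 * α.im) = 2 * Real.pi * δ * α.im by ring]
  field_simp

theorem sincKernel_conj_self (δ : ℝ) (α : ℂ) : sincKernel δ (conj α) α = δ := by
  simp [sincKernel]

theorem sincKernel_self_conj (δ : ℝ) (α : ℂ) : sincKernel δ α (conj α) = δ := by
  simp [sincKernel]

theorem sincKernel_conj_conj (δ : ℝ) {α : ℂ} (hα : α.im ≠ 0) :
    sincKernel δ (conj α) (conj α) = kernelDiag δ α.im := by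
  rw [← conj_sincKernel_conj, Complex.conj_conj, sincKernel_self δ hα, Complex.conj_ofReal]

theorem gramForm_eq (δ : ℝ) {α : ℂ} (hα : α.im ≠ 0) (l₁ l₂ : ℂ) :
    gramForm δ α l₁ l₂ = kernelDiag δ α.im * (‖l₁‖ ^ 2 + ‖l₂‖ ^ 2) +
      2 * δ * (l₁ * conj l₂).re := by
  rw [gramForm, sincKernel_self δ hα, sincKernel_conj_self, sincKernel_self_conj,
    sincKernel_conj_conj δ hα, ← Complex.normSq_eq_norm_sq, ← Complex.normSq_eq_norm_sq,
    Complex.normSq_apply, Complex.normSq_apply]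
  simp
  ring

/-- The extremal value, expressed with `y = Im α`. -/
noncomputable def extremalValue (y : ℝ) (β : ℂ) (δ : ℝ) : ℝ :=
  2 * (‖β‖ * kernelDiag δ y - δ * β.re) / (kernelDiag δ y ^ 2 - δ ^ 2)

theorem kernelDiag_sq_sub_sq_pos {δ y : ℝ} (hδ : 0 < δ) (hy : 0 < y) :
    0 < kernelDiag δ y ^ 2 - δ ^ 2 := by
  nlinarith [lt_kernelDiag hδ hy]

section
variable {δ : ℝ} {α : ℂ} (β : ℂ)

/-- `l₁ K(α, ·) + l₂ K(conj α, ·)` with `l₁ = interpolationCoeff K δ a b` and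
`l₂ = interpolationCoeff K δ b a` takes the values `a` and `b` at `α` and `conj α`, where
`K = K(α, α)`. -/
noncomputable def interpolationCoeff (K δ : ℝ) (a b : ℂ) : ℂ :=
  ((K : ℂ) * a - δ * b) / ((K ^ 2 - δ ^ 2 : ℝ) : ℂ)

theorem normSq_interpolationCoeff (K δ : ℝ) (a b : ℂ) : ‖interpolationCoeff K δ a b‖ ^ 2 =
    (K ^ 2 * ‖a‖ ^ 2 + δ ^ 2 * ‖b‖ ^ 2 - 2 * K * δ * (a * conj b).re) / (K ^ 2 - δ ^ 2) ^ 2 := by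
  rw [interpolationCoeff, norm_div, div_pow, Complex.norm_real, Real.norm_eq_abs, sq_abs]
  congr 1
  simp only [← Complex.normSq_eq_norm_sq, Complex.normSq_apply, Complex.mul_re, Complex.conj_re,
    Complex.conj_im, Complex.sub_re, Complex.sub_im, Complex.mul_im, Complex.ofReal_re,
    Complex.ofReal_im]
  ring

/-- The squared length of the shortest function with the values `a` and `b` at `α` and
`conj α`. -/
theorem extremalValue_add_defect (α : ℂ) (δ : ℝ) (a b : ℂ) :
    extremalValue α.im (a * conj b) δ +
        kernelDiag δ α.im * (‖a‖ - ‖b‖) ^ 2 / (kernelDiag δ α.im ^ 2 - δ ^ 2) =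
      (kernelDiag δ α.im * (‖a‖ ^ 2 + ‖b‖ ^ 2) - 2 * δ * (a * conj b).re) /
        (kernelDiag δ α.im ^ 2 - δ ^ 2) := by
  rw [extremalValue, norm_mul, RCLike.norm_conj, ← add_div]
  congr 1
  ring

/-- With coefficients `G⁻¹ v` the Gram form equals `v* G⁻¹ v`. -/
theorem gramForm_interpolationCoeff (hδ : 0 < δ) (hα : 0 < α.im) (a b : ℂ) :
    gramForm δ α (interpolationCoeff (kernelDiag δ α.im) δ a b)
        (interpolationCoeff (kernelDiag δ α.im) δ b a) =
      extremalValue α.im (a * conj b) δ +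
        kernelDiag δ α.im * (‖a‖ - ‖b‖) ^ 2 / (kernelDiag δ α.im ^ 2 - δ ^ 2) := by
  have hD := (kernelDiag_sq_sub_sq_pos hδ hα).ne'
  rw [extremalValue_add_defect, gramForm_eq δ hα.ne', normSq_interpolationCoeff,
    normSq_interpolationCoeff]
  set K := kernelDiag δ α.im
  have hcross : (interpolationCoeff K δ a b * conj (interpolationCoeff K δ b a)).re =
      ((K ^ 2 + δ ^ 2) * (a * conj b).re - K * δ * (‖a‖ ^ 2 + ‖b‖ ^ 2)) /
        (K ^ 2 - δ ^ 2) ^ 2 := by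
    rw [interpolationCoeff, interpolationCoeff, map_div₀, Complex.conj_ofReal, div_mul_div_comm,
      ← Complex.ofReal_mul, Complex.div_ofReal_re, ← sq]
    congr 1
    simp only [← Complex.normSq_eq_norm_sq, Complex.normSq_apply, Complex.mul_re, Complex.conj_re,
      Complex.conj_im, Complex.sub_re, Complex.sub_im, Complex.mul_im, Complex.ofReal_re,
      Complex.ofReal_im]
    ring
  have hsymm : (b * conj a).re = (a * conj b).re := by
    simp only [Complex.mul_re, Complex.conj_re, Complex.conj_im]
    ring
  rw [hcross, hsymm]
  field_simp
  ring

/-- The linear term at the coefficients `G⁻¹ v` is again `v* G⁻¹ v`, so the squared distance reduces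
to `∫ F - v* G⁻¹ v`. -/
theorem re_conj_interpolationCoeff_mul (α : ℂ) (δ : ℝ) (a b : ℂ) :
    (conj (interpolationCoeff (kernelDiag δ α.im) δ a b) * a +
        conj (interpolationCoeff (kernelDiag δ α.im) δ b a) * b).re =
      extremalValue α.im (a * conj b) δ +
        kernelDiag δ α.im * (‖a‖ - ‖b‖) ^ 2 / (kernelDiag δ α.im ^ 2 - δ ^ 2) := by
  rw [extremalValue_add_defect, interpolationCoeff, interpolationCoeff, map_div₀, map_div₀,
    Complex.conj_ofReal, div_mul_eq_mul_div, div_mul_eq_mul_div, ← add_div, Complex.div_ofReal_re]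
  congr 1
  simp only [← Complex.normSq_eq_norm_sq, Complex.normSq_apply, Complex.mul_re, Complex.conj_re,
    Complex.conj_im, Complex.sub_re, Complex.sub_im, Complex.mul_im, Complex.ofReal_re,
    Complex.ofReal_im, Complex.add_re]
  ring

theorem extremalF_eq_kernelSquare (α β : ℂ) (δ : ℝ) :
    extremalF α β δ = kernelSquare δ α (lambda₁ α β δ) (lambda₂ α β δ) := rfl

theorem norm_mul_div_norm (β : ℂ) : (‖β‖ : ℂ) * (β / (‖β‖ : ℂ)) = β := by
  by_cases h : β = 0
  · simp [h]
  · have : (‖β‖ : ℂ) ≠ 0 := by simpa using h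
    field_simp

theorem sqrt_norm_mul_self (β : ℂ) :
    ((Real.sqrt ‖β‖ : ℝ) : ℂ) * (Real.sqrt ‖β‖ : ℝ) = (‖β‖ : ℂ) := by
  rw [← Complex.ofReal_mul, Real.mul_self_sqrt (norm_nonneg _)]

theorem lambda₁_eq (hα : 0 < α.im) : lambda₁ α β δ = interpolationCoeff (kernelDiag δ α.im) δ
    (((Real.sqrt ‖β‖ : ℝ) : ℂ) * (β / (‖β‖ : ℂ))) ((Real.sqrt ‖β‖ : ℝ) : ℂ) := by
  rw [lambda₁, sincKernel_self δ hα.ne', interpolationCoeff]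
  push_cast
  ring

theorem lambda₂_eq (hα : 0 < α.im) : lambda₂ α β δ = interpolationCoeff (kernelDiag δ α.im) δ
    ((Real.sqrt ‖β‖ : ℝ) : ℂ) (((Real.sqrt ‖β‖ : ℝ) : ℂ) * (β / (‖β‖ : ℂ))) := by
  rw [lambda₂, sincKernel_self δ hα.ne', interpolationCoeff]
  push_cast
  ring

theorem kernelSquare_interpolationCoeff (hδ : 0 < δ) (hα : 0 < α.im) (a b : ℂ) :
    kernelSquare δ α (interpolationCoeff (kernelDiag δ α.im) δ a b)
      (interpolationCoeff (kernelDiag δ α.im) δ b a) α = a * conj b := by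
  have hD : ((kernelDiag δ α.im ^ 2 - δ ^ 2 : ℝ) : ℂ) ≠ 0 := by
    exact_mod_cast (kernelDiag_sq_sub_sq_pos hδ hα).ne'
  rw [kernelSquare, sincKernel_self δ hα.ne', sincKernel_conj_self, sincKernel_self_conj,
    sincKernel_conj_conj δ hα.ne', interpolationCoeff, interpolationCoeff]
  congr 1
  · field_simp; push_cast; ring
  · congr 1; field_simp; push_cast; ring

theorem sqrt_norm_mul_conj (β : ℂ) :
    ((Real.sqrt ‖β‖ : ℝ) : ℂ) * (β / (‖β‖ : ℂ)) * conj ((Real.sqrt ‖β‖ : ℝ) : ℂ) = β := by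
  rw [Complex.conj_ofReal, mul_right_comm, sqrt_norm_mul_self, norm_mul_div_norm]

theorem isAdmissible_extremalF (hδ : 0 < δ) (hα : 0 < α.im) :
    IsAdmissible α β δ (extremalF α β δ) := by
  have hval : kernelSquare δ α (lambda₁ α β δ) (lambda₂ α β δ) α = β := by
    rw [lambda₁_eq β hα, lambda₂_eq β hα, kernelSquare_interpolationCoeff hδ hα,
      sqrt_norm_mul_conj]
  have := isAdmissible_kernelSquare (lambda₁ α β δ) (lambda₂ α β δ) hδ.le hα.ne'
  rwa [hval] at this

theorem lineIntegral_extremalF (hδ : 0 < δ) (hα : 0 < α.im) :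
    lineIntegral (extremalF α β δ) = extremalValue α.im β δ := by
  -- The two prescribed values have equal modulus, so the defect vanishes; for `β = 0` both are
  -- zero.
  have hnorm : ‖((Real.sqrt ‖β‖ : ℝ) : ℂ) * (β / (‖β‖ : ℂ))‖ = ‖((Real.sqrt ‖β‖ : ℝ) : ℂ)‖ := by
    by_cases hβ : β = 0
    · simp [hβ]
    · rw [norm_mul, norm_div, Complex.norm_real ‖β‖, norm_norm, div_self (by simpa using hβ),
        mul_one]
  rw [extremalF_eq_kernelSquare, lineIntegral_kernelSquare _ _ hδ.le hα.ne', lambda₁_eq β hα,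
    lambda₂_eq β hα, gramForm_interpolationCoeff hδ hα, sqrt_norm_mul_conj, hnorm]
  simp

/-! ### Lower bound, uniqueness and the theorem. -/

theorem extremalValue_le (hδ : 0 < δ) (hα : 0 < α.im) {F : ℂ → ℂ} (hF : IsAdmissible α β δ F) :
    extremalValue α.im β δ ≤ lineIntegral F ∧
      (lineIntegral F = extremalValue α.im β δ → F = extremalF α β δ) := by
  obtain ⟨a, b, hab, H⟩ := hF.exists_values hδ
  have hG := gramForm_interpolationCoeff hδ hα a b
  have hP := re_conj_interpolationCoeff_mul α δ a b
  set K := kernelDiag δ α.im with hK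
  obtain ⟨hnonneg, heq⟩ := H (interpolationCoeff K δ a b) (interpolationCoeff K δ b a)
  rw [hab] at hG hP
  have hKpos : 0 < K := hδ.trans (lt_kernelDiag hδ hα)
  have hD : 0 < K ^ 2 - δ ^ 2 := kernelDiag_sq_sub_sq_pos hδ hα
  have hdefect : 0 ≤ K * (‖a‖ - ‖b‖) ^ 2 / (K ^ 2 - δ ^ 2) := by positivity
  refine ⟨by linarith, fun hI => ?_⟩
  have hdef0 : K * (‖a‖ - ‖b‖) ^ 2 / (K ^ 2 - δ ^ 2) = 0 := by linarith
  have hnorm : ‖a‖ = ‖b‖ := by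
    have := (div_eq_zero_iff.1 hdef0).resolve_right hD.ne'
    have := pow_eq_zero_iff two_ne_zero |>.1 ((mul_eq_zero.1 this).resolve_left hKpos.ne')
    linarith
  have hF' := heq (by linarith)
  have hβ : ‖b‖ = Real.sqrt ‖β‖ := by
    rw [← hab, norm_mul, RCLike.norm_conj, hnorm, Real.sqrt_mul_self (norm_nonneg _)]
  -- Equal moduli and `a * conj b = β` determine `(a, b)` up to the common phase `c = b / ‖b‖`, with
  -- `c = 1` if `b = 0`.
  obtain ⟨c, hc, hca, hcb⟩ : ∃ c : ℂ, c * conj c = 1 ∧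
      a = c * (((Real.sqrt ‖β‖ : ℝ) : ℂ) * (β / (‖β‖ : ℂ))) ∧
      b = c * ((Real.sqrt ‖β‖ : ℝ) : ℂ) := by
    by_cases hb : b = 0
    · have ha : a = 0 := by rw [hb, norm_zero] at hnorm; exact norm_eq_zero.1 hnorm
      have hβ0 : Real.sqrt ‖β‖ = 0 := by rw [← hβ, hb, norm_zero]
      exact ⟨1, by simp, by simp [ha, hβ0], by simp [hb, hβ0]⟩
    · have hbn : (‖b‖ : ℂ) ≠ 0 := by simpa using hb
      have hbb : b * conj b = (‖b‖ : ℂ) ^ 2 := by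
        rw [Complex.mul_conj, Complex.normSq_eq_norm_sq]; push_cast; rfl
      have hβn : (‖β‖ : ℂ) = (‖b‖ : ℂ) ^ 2 := by
        rw [← sqrt_norm_mul_self, ← hβ, sq]
      refine ⟨b / (‖b‖ : ℂ), ?_, ?_, ?_⟩
      · rw [map_div₀, Complex.conj_ofReal, div_mul_div_comm, hbb]
        field_simp
      · rw [← hβ, hβn]
        rw [← hab]
        field_simp
        linear_combination (-a) * hbb
      · rw [← hβ]
        field_simp
  have hl₁ : interpolationCoeff K δ a b = c * lambda₁ α β δ := by
    rw [lambda₁_eq β hα, hca, hcb, interpolationCoeff, interpolationCoeff]; ring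
  have hl₂ : interpolationCoeff K δ b a = c * lambda₂ α β δ := by
    rw [lambda₂_eq β hα, hca, hcb, interpolationCoeff, interpolationCoeff]; ring
  ext z
  -- The coefficients are linear in `(a, b)`, so `c` multiplies `U` and drops out of `U U*`.
  rw [hF' z, hl₁, hl₂, extremalF, extremalU, extremalU]
  simp only [map_add, map_mul]
  linear_combination ((lambda₁ α β δ * sincKernel δ α z +
    lambda₂ α β δ * sincKernel δ (conj α) z) *
      (conj (lambda₁ α β δ) * conj (sincKernel δ α (conj z)) +
        conj (lambda₂ α β δ) * conj (sincKernel δ (conj α) (conj z)))) * hc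

theorem kappa_eq_extremalValue (hδ : 0 < δ) (hα : 0 < α.im) :
    kappa α β δ = extremalValue α.im β δ := by
  refine IsLeast.csInf_eq ⟨⟨_, isAdmissible_extremalF β hδ hα,
    (lineIntegral_extremalF β hδ hα).symm⟩, ?_⟩
  rintro _ ⟨F, hF, rfl⟩
  exact (extremalValue_le β hδ hα hF).1

end

theorem theorem2 (δ : ℝ) (hδ : 0 < δ) (α : ℂ) (hα : 0 < α.im) (β : ℂ) :
    kappa α β δ = ‖β‖ * kappa α (β / (‖β‖ : ℂ)) δ ∧
    (∀ r : ℝ, 0 < r → kappa α β δ = r⁻¹ * kappa ((r : ℂ) * α) β (r⁻¹ * δ)) ∧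
    (∀ t : ℝ, kappa α β δ = kappa (α + (t : ℂ)) β δ) ∧
    (sincKernel δ α α ^ 2 - (δ : ℂ) ^ 2 ≠ 0 ∧
      (kappa α β δ : ℂ) / 2 =
        ((‖β‖ : ℂ) * sincKernel δ α α - (δ : ℂ) * (β.re : ℂ)) /
          (sincKernel δ α α ^ 2 - (δ : ℂ) ^ 2)) ∧
    (IsAdmissible α β δ (extremalF α β δ) ∧
      lineIntegral (extremalF α β δ) = kappa α β δ ∧
      ∀ F : ℂ → ℂ, IsAdmissible α β δ F → lineIntegral F = kappa α β δ →
        F = extremalF α β δ) := by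
  have hD := (kernelDiag_sq_sub_sq_pos hδ hα).ne'
  refine ⟨?_, fun r hr => ?_, fun t => ?_, ⟨?_, ?_⟩, isAdmissible_extremalF β hδ hα, ?_,
    fun F hF hI => ?_⟩
  · rw [kappa_eq_extremalValue _ hδ hα, kappa_eq_extremalValue _ hδ hα, extremalValue,
      extremalValue, Complex.div_ofReal_re, norm_div, Complex.norm_real, norm_norm]
    by_cases hβ : β = 0
    · simp [hβ]
    · have : ‖β‖ ≠ 0 := by simpa using hβ
      field_simp
  · have hrα : 0 < ((r : ℂ) * α).im := by
      rw [Complex.im_ofReal_mul]; positivity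
    rw [kappa_eq_extremalValue _ hδ hα, kappa_eq_extremalValue _ (by positivity) hrα,
      Complex.im_ofReal_mul]
    -- The product `δ * α.im` is invariant under the scaling, so only the denominator changes.
    have hk : kernelDiag (r⁻¹ * δ) (r * α.im) = r⁻¹ * kernelDiag δ α.im := by
      rw [kernelDiag, kernelDiag,
        show 2 * Real.pi * (r⁻¹ * δ) * (r * α.im) = 2 * Real.pi * δ * α.im by field_simp]
      field_simp
    rw [extremalValue, extremalValue, hk,
      show (r⁻¹ * kernelDiag δ α.im) ^ 2 - (r⁻¹ * δ) ^ 2 =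
        r⁻¹ ^ 2 * (kernelDiag δ α.im ^ 2 - δ ^ 2) by ring]
    field_simp
  · have htα : (α + (t : ℂ)).im = α.im := by simp
    rw [kappa_eq_extremalValue _ hδ hα, kappa_eq_extremalValue _ hδ (by rwa [htα]), htα]
  · rw [sincKernel_self δ hα.ne']
    exact_mod_cast hD
  · rw [sincKernel_self δ hα.ne', kappa_eq_extremalValue _ hδ hα, extremalValue]
    push_cast
    ring
  · rw [lineIntegral_extremalF β hδ hα, kappa_eq_extremalValue _ hδ hα]
  · rw [kappa_eq_extremalValue _ hδ hα] at hI
    exact (extremalValue_le β hδ hα hF).2 hI
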